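/- Let $\mathcal H$ be a complex Hilbert space. For a measurable space $X$, a POVM on $X$ is a map $F$ from the measurable subsets of $X$ to the positive bounded operators on $\mathcal H$ that is countably additive in the weak operator topology; it is normalized if $F(X)=\mathbf 1$, commutative if $F(\Delta_1)F(\Delta_2)=F(\Delta_2)F(\Delta_1)$ for all measurable $\Delta_1,\Delta_2$, and a PVM if it is normalized and $F(\Delta_1)F(\Delta_2)=\mathbf 0$ whenever $\Delta_1\cap\Delta_2=\emptyset$. One writes $B=\int_\Gamma f\,dF$ if $\langle Bx,x\rangle=\int_\Gamma f\,d\langle F(\cdot)x,x\rangle$ for all $x\in\mathcal H$. A map $\mu:\Lambda\times\mathcal B(\mathbb R)\to[0,1]$, $(\lambda,\Delta)\mapsto\mu_\Delta(\lambda)$, with $\Lambda$ a measurable space, is a Markov kernel if $\mu_\Delta$ is measurable for every Borel $\Delta$ and $\mu_{(\cdot)}(\lambda)$ is a probability measure for every $\lambda\in\Lambda$. If $\Lambda$ is a topological space with its Borel $\sigma$-algebra, a Markov kernel is Feller if $\lambda\mapsto\int_{\mathbb R} f(t)\,\mu_{(dt)}(\lambda)$ is continuous and bounded on $\Lambda$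 for every bounded continuous $f:\mathbb R\to\mathbb R$. For a PVM $E$ on $\Lambda$, $\mu$ is a weak Markov kernel with respect to $E$ if each $\mu_\Delta$ is measurable and, almost everywhere with respect to each of the measures $\langle E(\cdot)x,x\rangle$, $x\in\mathcal H$, one has $\mu_{\mathbb R}=1$, $\mu_\emptyset=0$ and, for each sequence $(\Delta_i)$ of pairwise disjoint Borel sets, $\sum_i\mu_{\Delta_i}=\mu_{\bigcup_i\Delta_i}$ (the exceptional null set may depend on the sequence). A strong Markov kernel $(\mu,E,\Gamma\subset\Lambda)$ is a weak Markov kernel $\mu$ with respect to $E$ together with a measurable set $\Gamma\subset\Lambda$ such that $E(\Gamma)=\mathbf 1$ and the restriction of $\mu$ to $\Gamma\times\mathcal B(\mathbb R)$ is a Markov kernel. Let $\mathcal R(\mathcal S)$ be the ring of sets generated by the family $\mathcal S$ of the open intervals $(a,b)$ with $a,b\in\mathbb Q$. **Theorem.** A normalized POVM $F$ on $\mathcal B(\mathbb R)$ is commutative if and only if there are a bounded self-adjoint operator $A$ on $\mathcal H$ with spectrum $\sigma(A)\subset[0,1]$, a PVM $E$ on $\mathcal B(\sigma(A))$ with $A=\int_{\sigma(A)}\lambda\,dE_\lambda$,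 and a strong Markov kernel $(\mu,E,\Gamma\subset\sigma(A))$ such that 1. $\mu_\Delta:\sigma(A)\to[0,1]$ is continuous for each $\Delta\in\mathcal R(\mathcal S)$; 2. $F(\Delta)=\int_\Gamma\mu_\Delta(\lambda)\,dE_\lambda$ for each $\Delta\in\mathcal B(\mathbb R)$; 3. $\mu$ separates the points of $\Gamma$: for $\lambda\ne\lambda'$ in $\Gamma$ there is a Borel set $\Delta$ with $\mu_\Delta(\lambda)\neq\mu_\Delta(\lambda')$. Moreover, for all such $A$, $E$, $\mu$ and $\Gamma$, the restriction $\mu:\Gamma\times\mathcal B(\mathbb R)\to[0,1]$ is a Feller Markov kernel. -/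

import Mathlib

open MeasureTheory ProbabilityTheory

noncomputable section

/-- A positive operator valued measure on a measurable space: a map from the measurable sets to
the positive bounded operators which is countably additive in the weak operator topology.
(Values on non-measurable sets are irrelevant and are never used.) -/
structure POVM (α : Type*) [MeasurableSpace α] (H : Type*) [NormedAddCommGroup H]
    [InnerProductSpace ℂ H] [CompleteSpace H] where
  /-- the operator attached to a set -/
  toFun : Set α → (H →L[ℂ] H)
  isPositive : ∀ Δ : Set α, MeasurableSet Δ → (toFun Δ).IsPositive
  hasSum_iUnion : ∀ Δ : ℕ → Set α, (∀ n, MeasurableSet (Δ n)) →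
    Pairwise (fun i j => Disjoint (Δ i) (Δ j)) →
    ∀ x y : H, HasSum (fun n => inner ℂ (toFun (Δ n) x) y) (inner ℂ (toFun (⋃ n, Δ n) x) y)

namespace POVM

variable {α : Type*} [MeasurableSpace α] {H : Type*} [NormedAddCommGroup H]
  [InnerProductSpace ℂ H] [CompleteSpace H]

instance : CoeFun (POVM α H) (fun _ => Set α → (H →L[ℂ] H)) := ⟨POVM.toFun⟩

/-- `F` is normalized if the whole space has measure `1`. -/
def IsNormalized (F : POVM α H) : Prop := F Set.univ = 1

/-- `F` is commutative if any two of its values commute. -/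
def IsCommutative (F : POVM α H) : Prop :=
  ∀ Δ₁ Δ₂ : Set α, MeasurableSet Δ₁ → MeasurableSet Δ₂ → Commute (F Δ₁) (F Δ₂)

/-- `F` is orthogonal if its values on disjoint sets have product `0`. -/
def IsOrthogonal (F : POVM α H) : Prop :=
  ∀ Δ₁ Δ₂ : Set α, MeasurableSet Δ₁ → MeasurableSet Δ₂ → Disjoint Δ₁ Δ₂ → F Δ₁ * F Δ₂ = 0

/-- A projection valued measure is an orthogonal, normalized POVM. -/
def IsPVM (F : POVM α H) : Prop := F.IsOrthogonal ∧ F.IsNormalized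

theorem inner_empty (F : POVM α H) (x y : H) : inner ℂ (F ∅ x) y = 0 := by
  have h := F.hasSum_iUnion (fun _ => ∅) (fun _ => MeasurableSet.empty)
    (fun _ _ _ => disjoint_bot_left) x y
  exact tendsto_nhds_unique tendsto_const_nhds h.summable.tendsto_atTop_zero

/-- The finite measure `Δ ↦ ⟨F(Δ) x, x⟩`. -/
def scalarMeasure (F : POVM α H) (x : H) : Measure α :=
  Measure.ofMeasurable (fun Δ _ => ENNReal.ofReal (RCLike.re (inner ℂ (F Δ x) x)))
    (by simp [F.inner_empty])
    (by
      intro Δ hΔ hd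
      have h := RCLike.reCLM.hasSum (F.hasSum_iUnion Δ hΔ hd x x)
      have h' : HasSum (fun n => RCLike.re (inner ℂ (F (Δ n) x) x))
          (RCLike.re (inner ℂ (F (⋃ n, Δ n) x) x)) := h
      rw [← h'.tsum_eq]
      exact ENNReal.ofReal_tsum_of_nonneg
        (fun n => (F.isPositive (Δ n) (hΔ n)).re_inner_nonneg_left x) h'.summable)

theorem scalarMeasure_apply (F : POVM α H) (x : H) {Δ : Set α} (hΔ : MeasurableSet Δ) :
    F.scalarMeasure x Δ = ENNReal.ofReal (RCLike.re (inner ℂ (F Δ x) x)) :=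
  Measure.ofMeasurable_apply Δ hΔ

/-- `B = ∫_Γ f dF`, i.e. `⟨B x, x⟩ = ∫_Γ f(l) d⟨F(l) x, x⟩` for every vector `x`, where the
scalar integrals exist. -/
def HasIntegral (F : POVM α H) (Γ : Set α) (f : α → ℝ) (B : H →L[ℂ] H) : Prop :=
  ∀ x : H, IntegrableOn f Γ (F.scalarMeasure x) ∧
    inner ℂ (B x) x = ((∫ l in Γ, f l ∂(F.scalarMeasure x) : ℝ) : ℂ)

end POVM

/-- The ring of sets generated by the open intervals of `ℝ` with rational end-points. -/
def rationalRing : Set (Set ℝ) :=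
  ⋂₀ {C | IsSetRing C ∧ ∀ a b : ℚ, Set.Ioo (a : ℝ) (b : ℝ) ∈ C}

section Kernels

/- A map `Λ × 𝓑(ℝ) → [0,1]`, `(l, Δ) ↦ μ_Δ(l)`, is written `μ : Set ℝ → Λ → ℝ` with values
`μ Δ l`; only Borel sets `Δ` matter. -/

variable {Λ : Type*} [MeasurableSpace Λ]

/-- `μ` is a Markov kernel: each `μ_Δ` is measurable and each `μ_(·)(l)` is a probability
measure on `ℝ`, i.e. `μ` is given by a Markov kernel in the sense of Mathlib. -/
def IsMarkovMap (μ : Set ℝ → Λ → ℝ) : Prop :=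
  ∃ κ : Kernel Λ ℝ, IsMarkovKernel κ ∧
    ∀ Δ : Set ℝ, MeasurableSet Δ → ∀ l : Λ, μ Δ l = (κ l).real Δ

/-- `μ` is a Feller Markov kernel: a Markov kernel which maps bounded continuous functions to
bounded continuous functions. -/
def IsFellerMarkovMap [TopologicalSpace Λ] (μ : Set ℝ → Λ → ℝ) : Prop :=
  ∃ κ : Kernel Λ ℝ, IsMarkovKernel κ ∧
    (∀ Δ : Set ℝ, MeasurableSet Δ → ∀ l : Λ, μ Δ l = (κ l).real Δ) ∧
    ∀ f : BoundedContinuousFunction ℝ ℝ,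
      Continuous (fun l => ∫ t, f t ∂(κ l)) ∧ ∃ C : ℝ, ∀ l, |∫ t, f t ∂(κ l)| ≤ C

/-- `μ : Λ × 𝓑(ℝ) → [0,1]` is a weak Markov kernel with respect to the measure `ν`. -/
structure IsWeakMarkovMap (ν : Measure Λ) (μ : Set ℝ → Λ → ℝ) : Prop where
  mem_Icc : ∀ Δ : Set ℝ, MeasurableSet Δ → ∀ l : Λ, μ Δ l ∈ Set.Icc (0 : ℝ) 1
  measurable : ∀ Δ : Set ℝ, MeasurableSet Δ → Measurable (μ Δ)
  univ_ae : ∀ᵐ l ∂ν, μ Set.univ l = 1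
  empty_ae : ∀ᵐ l ∂ν, μ ∅ l = 0
  hasSum_ae : ∀ Δ : ℕ → Set ℝ, (∀ n, MeasurableSet (Δ n)) →
    Pairwise (fun i j => Disjoint (Δ i) (Δ j)) →
    ∀ᵐ l ∂ν, HasSum (fun n => μ (Δ n) l) (μ (⋃ n, Δ n) l)

variable {H : Type*} [NormedAddCommGroup H] [InnerProductSpace ℂ H] [CompleteSpace H]

/-- `(μ, E, Γ ⊂ Λ)` is a strong Markov kernel with respect to the PVM `E`: it is a weak Markov
kernel with respect to all the measures `⟨E(·) x, x⟩`, the Borel set `Γ` satisfies `E(Γ) = 1`,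
and the restriction of `μ` to `Γ` is a Markov kernel. -/
structure IsStrongMarkovMap (μ : Set ℝ → Λ → ℝ) (E : POVM Λ H) (Γ : Set Λ) : Prop where
  isPVM : E.IsPVM
  weak : ∀ x : H, IsWeakMarkovMap (E.scalarMeasure x) μ
  measurableSet : MeasurableSet Γ
  apply_eq_one : E Γ = 1
  markov : IsMarkovMap (fun Δ (l : Γ) => μ Δ l)

/-- The family `{μ_Δ}`, `Δ` Borel, separates the points of `Γ`. -/
def SeparatesPointsOn (μ : Set ℝ → Λ → ℝ) (Γ : Set Λ) : Prop :=
  ∀ l ∈ Γ, ∀ l' ∈ Γ, l ≠ l' → ∃ Δ : Set ℝ, MeasurableSet Δ ∧ μ Δ l ≠ μ Δ l'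

/-- `A = ∫ l dE(l)` is a bounded self-adjoint operator with spectrum in `[0,1]`, and
`(μ, E, Γ ⊂ σ(A))` is a strong Markov kernel with the properties (1) continuity of `μ_Δ` on
`σ(A)` for `Δ` in the ring generated by the rational open intervals, (2) `F(Δ) = ∫_Γ μ_Δ dE` for
all Borel `Δ`, (3) separation of the points of `Γ`. -/
structure IsSharpRepresentation (F : POVM ℝ H) (A : H →L[ℂ] H) (E : POVM (spectrum ℝ A) H)
    (μ : Set ℝ → spectrum ℝ A → ℝ) (Γ : Set (spectrum ℝ A)) : Prop where
  isSelfAdjoint : IsSelfAdjoint A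
  spectrum_subset : spectrum ℝ A ⊆ Set.Icc 0 1
  eq_integral : E.HasIntegral Set.univ (fun l => (l : ℝ)) A
  strong : IsStrongMarkovMap μ E Γ
  continuous : ∀ Δ ∈ rationalRing, Continuous (μ Δ)
  smearing : ∀ Δ : Set ℝ, MeasurableSet Δ → E.HasIntegral Γ (μ Δ) (F Δ)
  separates : SeparatesPointsOn μ Γ

end Kernels

end

noncomputable section

open Filter Topology
open scoped NNReal ENNReal

/-! A normalized POVM on `ℝ` is determined by its values on a countable algebra of sets, and
countably many commuting positive contractions are continuous functions of one self-adjoint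
operator. To see the latter, replace each contraction by its spectral projections for the half-lines
`[q, ∞)`, `q` rational, enumerate all of these as `P k`, and put `A = ∑ 2 · 3⁻⁽ᵏ⁺¹⁾ P k`. A
character sends every `P k` to `0` or `1`, hence `A` to a point of the Cantor set, where the ternary
digits are continuous functions; so `P k` is the `k`-th digit of `A` (`cfc_digit_of_hasSum`,
`exists_generator`). Each contraction is a norm limit of averages of its own projections and
therefore also a continuous function of `A`. Almost everywhere the values of these functions
determine all digits, hence the spectral point, which gives the separation property
(`exists_separating_generator`).

For the kernel, the functions representing `F (-∞, q]` are almost everywhere the rational values of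
a distribution function; this yields a Markov kernel whose integral against the spectral resolution
of `A` is `F` (`exists_kernel`). On the countable algebra the kernel agrees with the continuous
representatives off a single set that is null for every vector. Overwriting it there by these
representatives makes it continuous in the spectral variable.

Conversely, an integral against a PVM is a norm limit of averages of commuting projections
(`HasIntegral.commute`), so a smearing of a PVM is commutative. The Feller property holds because
convergence on rational open intervals implies weak convergence of probability measures.

The spectral resolution itself is built from the continuous functional calculus through the
Riesz–Markov theorem (`spectralPOVM`, `spectralPOVM_isPVM`). -/

theorem ContinuousLinearMap.ext_inner_self {H : Type*} [NormedAddCommGroup H]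
    [InnerProductSpace ℂ H] {S T : H →L[ℂ] H} (h : ∀ x, inner ℂ (S x) x = inner ℂ (T x) x) : S = T := by
  have := (ext_inner_map (S : H →ₗ[ℂ] H) (T : H →ₗ[ℂ] H)).1 h
  ext x
  exact LinearMap.congr_fun this x

/-! ### Operator-valued measures and their integrals -/

namespace POVM

variable {α : Type*} [MeasurableSpace α] {H : Type*} [NormedAddCommGroup H]
  [InnerProductSpace ℂ H] [CompleteSpace H]

instance isFiniteMeasure_scalarMeasure (F : POVM α H) (x : H) :
    IsFiniteMeasure (F.scalarMeasure x) :=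
  ⟨by rw [F.scalarMeasure_apply x MeasurableSet.univ]; exact ENNReal.ofReal_lt_top⟩

theorem scalarMeasure_real (F : POVM α H) (x : H) {Δ : Set α} (hΔ : MeasurableSet Δ) :
    (F.scalarMeasure x).real Δ = RCLike.re (inner ℂ (F Δ x) x) := by
  rw [measureReal_def, F.scalarMeasure_apply x hΔ,
    ENNReal.toReal_ofReal ((F.isPositive Δ hΔ).re_inner_nonneg_left x)]

theorem inner_apply_self (F : POVM α H) (x : H) {Δ : Set α} (hΔ : MeasurableSet Δ) :
    inner ℂ (F Δ x) x = (((F.scalarMeasure x).real Δ : ℝ) : ℂ) := by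
  rw [F.scalarMeasure_real x hΔ]
  exact ((F.isPositive Δ hΔ).toLinearMap.isSymmetric.coe_re_inner_apply_self x).symm

theorem apply_empty (F : POVM α H) : F ∅ = 0 :=
  ContinuousLinearMap.ext_inner_self fun x => by simp [F.inner_empty]

theorem apply_union (F : POVM α H) {S T : Set α} (hS : MeasurableSet S) (hT : MeasurableSet T)
    (hd : Disjoint S T) : F (S ∪ T) = F S + F T :=
  ContinuousLinearMap.ext_inner_self fun x => by
    rw [add_apply, inner_add_left, F.inner_apply_self x (hS.union hT),
      F.inner_apply_self x hS, F.inner_apply_self x hT, measureReal_union hd hT]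
    push_cast; rfl

theorem isSelfAdjoint_apply (F : POVM α H) {Δ : Set α} (hΔ : MeasurableSet Δ) :
    IsSelfAdjoint (F Δ) := (F.isPositive Δ hΔ).isSelfAdjoint

theorem apply_compl (F : POVM α H) (hF : F.IsNormalized) {S : Set α} (hS : MeasurableSet S) :
    F Sᶜ = 1 - F S := by
  rw [eq_sub_iff_add_eq', ← F.apply_union hS hS.compl disjoint_compl_right, Set.union_compl_self]
  exact hF

theorem IsPVM.apply_mul_self {E : POVM α H} (hE : E.IsPVM) {S : Set α} (hS : MeasurableSet S) :
    E S * E S = E S := by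
  have h := hE.1 S Sᶜ hS hS.compl disjoint_compl_right
  rw [E.apply_compl hE.2 hS, mul_sub, mul_one, sub_eq_zero] at h
  exact h.symm

/-- Split `S` and `T` along their intersection: by orthogonality all mixed products vanish and only
the square of the common piece survives. -/
theorem IsPVM.apply_inter {E : POVM α H} (hE : E.IsPVM) {S T : Set α} (hS : MeasurableSet S)
    (hT : MeasurableSet T) : E (S ∩ T) = E S * E T := by
  have h1 : E S = E (S ∩ T) + E (S \ T) := by
    rw [← E.apply_union (hS.inter hT) (hS.diff hT) (Set.disjoint_sdiff_inter.symm),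
      Set.inter_union_sdiff]
  have h2 : E T = E (S ∩ T) + E (T \ S) := by
    rw [Set.inter_comm, ← E.apply_union (hT.inter hS) (hT.diff hS) (Set.disjoint_sdiff_inter.symm),
      Set.inter_union_sdiff]
  have d1 : Disjoint (S ∩ T) (T \ S) := by
    rw [Set.disjoint_left]; rintro x ⟨h, _⟩ ⟨_, h'⟩; exact h' h
  have d2 : Disjoint (S \ T) (S ∩ T) := Set.disjoint_sdiff_inter
  have d3 : Disjoint (S \ T) (T \ S) := by
    rw [Set.disjoint_left]; rintro x ⟨h, _⟩ ⟨_, h'⟩; exact h' h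
  rw [h1, h2, add_mul, mul_add, mul_add, hE.apply_mul_self (hS.inter hT),
    hE.1 _ _ (hS.inter hT) (hT.diff hS) d1, hE.1 _ _ (hS.diff hT) (hS.inter hT) d2,
    hE.1 _ _ (hS.diff hT) (hT.diff hS) d3]
  simp

theorem IsPVM.isCommutative {E : POVM α H} (hE : E.IsPVM) : E.IsCommutative := by
  intro S T hS hT
  rw [Commute, SemiconjBy, ← hE.apply_inter hS hT, ← hE.apply_inter hT hS, Set.inter_comm]

/-- Cutting the vector down by `E S` amounts to restricting the scalar measure to `S`. -/
theorem IsPVM.scalarMeasure_apply_vector {E : POVM α H} (hE : E.IsPVM) {S : Set α}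
    (hS : MeasurableSet S) (x : H) :
    E.scalarMeasure (E S x) = (E.scalarMeasure x).restrict S := by
  ext Δ hΔ
  rw [Measure.restrict_apply hΔ, E.scalarMeasure_apply _ hΔ,
    E.scalarMeasure_apply x (hΔ.inter hS), ← ContinuousLinearMap.adjoint_inner_left,
    (E.isSelfAdjoint_apply hS).adjoint_eq, ← mul_apply_eq_comp,
    ← mul_apply_eq_comp, mul_assoc, ← hE.apply_inter hΔ hS, ← hE.apply_inter hS (hΔ.inter hS),
    Set.inter_eq_right.2 Set.inter_subset_right]

theorem HasIntegral.isSelfAdjoint {F : POVM α H} {Γ : Set α} {f : α → ℝ} {B : H →L[ℂ] H}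
    (h : F.HasIntegral Γ f B) : IsSelfAdjoint B := by
  rw [ContinuousLinearMap.isSelfAdjoint_iff_isSymmetric, LinearMap.isSymmetric_iff_inner_map_self_real]
  intro x
  erw [(h x).2]
  exact Complex.conj_ofReal _

theorem norm_le_of_isPositive {D : H →L[ℂ] H} (hD : IsSelfAdjoint D) {r : ℝ} (hr : 0 ≤ r)
    (h0 : ∀ x, 0 ≤ RCLike.re (inner ℂ (D x) x))
    (h1 : ∀ x, RCLike.re (inner ℂ (D x) x) ≤ r * ‖x‖ ^ 2) : ‖D‖ ≤ r := by
  have hD0 : 0 ≤ D := by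
    rw [ContinuousLinearMap.nonneg_iff_isPositive]
    exact ⟨ContinuousLinearMap.isSelfAdjoint_iff_isSymmetric.1 hD, h0⟩
  rw [CStarAlgebra.norm_le_iff_le_algebraMap D hr hD0, ContinuousLinearMap.le_def]
  have hs : IsSelfAdjoint (algebraMap ℝ (H →L[ℂ] H) r - D) :=
    (IsSelfAdjoint.algebraMap _ (.all r)).sub hD
  refine ⟨ContinuousLinearMap.isSelfAdjoint_iff_isSymmetric.1 hs, fun x => ?_⟩
  have := h1 x
  have e : RCLike.re (inner ℂ ((algebraMap ℝ (H →L[ℂ] H) r) x) x) = r * ‖x‖ ^ 2 := by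
    rw [Algebra.algebraMap_eq_smul_one, smul_apply,
      one_apply_eq_self, inner_smul_left_eq_smul, RCLike.smul_re,
      inner_self_eq_norm_sq]
  simp only [ContinuousLinearMap.reApplyInnerSelf, sub_apply, inner_sub_left,
    map_sub, e]
  linarith

/-- The floor of `N * t` counts the levels `1/N, ..., N/N` lying below or at `t`. This discrete
layer-cake formula turns superlevel sets into a uniform approximation with error at most `1/N`. -/
theorem sum_indicator_eq_floor {N : ℕ} (hN : 0 < N) {t : ℝ} (h0 : 0 ≤ t) (h1 : t ≤ 1) :
    ∑ k ∈ Finset.range N, (if ((k + 1 : ℝ) / N ≤ t) then (1 : ℝ) else 0) = ⌊(N : ℝ) * t⌋₊ := by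
  have hN' : (0 : ℝ) < N := by exact_mod_cast hN
  have hle : ⌊(N : ℝ) * t⌋₊ ≤ N := Nat.floor_le_of_le (by nlinarith)
  rw [Finset.sum_boole, Nat.cast_inj]
  have : (Finset.range N).filter (fun k : ℕ => ((k + 1 : ℝ) / N ≤ t))
      = Finset.range ⌊(N : ℝ) * t⌋₊ := by
    ext k
    have : ((k + 1 : ℝ) / N ≤ t) ↔ k + 1 ≤ ⌊(N : ℝ) * t⌋₊ := by
      rw [Nat.le_floor_iff (by positivity), div_le_iff₀ hN', mul_comm t]; push_cast; rfl
    simp only [Finset.mem_filter, Finset.mem_range, this]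
    omega
  rw [this, Finset.card_range]

theorem integral_floor {E : POVM α H} {Γ : Set α} (hΓ : MeasurableSet Γ) {f : α → ℝ}
    (hf : Measurable f) (h0 : ∀ a, 0 ≤ f a) (h1 : ∀ a, f a ≤ 1) {N : ℕ} (hN : 0 < N) (x : H) :
    ∫ a in Γ, (⌊(N : ℝ) * f a⌋₊ : ℝ) ∂(E.scalarMeasure x) =
      RCLike.re (inner ℂ
        ((∑ k ∈ Finset.range N, E (Γ ∩ {a | (k + 1 : ℝ) / N ≤ f a})) x) x) := by
  have hms : ∀ k : ℕ, MeasurableSet {a | (k + 1 : ℝ) / N ≤ f a} := fun k =>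
    measurableSet_le measurable_const hf
  simp_rw [← sum_indicator_eq_floor hN (h0 _) (h1 _)]
  rw [integral_finsetSum, sum_apply, sum_inner, map_sum]
  · refine Finset.sum_congr rfl fun k _ => ?_
    have : (fun a => if ((k + 1 : ℝ) / N ≤ f a) then (1 : ℝ) else 0) =
        {a | (k + 1 : ℝ) / N ≤ f a}.indicator 1 := by
      ext a; simp [Set.indicator_apply]
    rw [this, integral_indicator_one (hms k), measureReal_restrict_apply (hms k),
      Set.inter_comm Γ, E.scalarMeasure_real x ((hms k).inter hΓ)]
  · intro k _
    refine Integrable.of_bound (C := 1)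
      (Measurable.ite (hms k) measurable_const measurable_const).aestronglyMeasurable
      (ae_of_all _ fun a => ?_)
    split_ifs <;> simp

theorem IsNormalized.scalarMeasure_univ {E : POVM α H} (hE : E.IsNormalized) (x : H) :
    (E.scalarMeasure x).real Set.univ = ‖x‖ ^ 2 := by
  rw [E.scalarMeasure_real x .univ, hE, one_apply_eq_self, inner_self_eq_norm_sq]

/-- The integral of a `[0,1]`-valued function is approximated in norm by averages of the operators
attached to its super-level sets. -/
theorem HasIntegral.norm_sub_sum_le {E : POVM α H} (hE : E.IsNormalized) {Γ : Set α}
    (hΓ : MeasurableSet Γ) {f : α → ℝ} (hf : Measurable f) (h0 : ∀ a, 0 ≤ f a) (h1 : ∀ a, f a ≤ 1)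
    {B : H →L[ℂ] H} (hB : E.HasIntegral Γ f B) {N : ℕ} (hN : 0 < N) :
    ‖B - (N : ℝ)⁻¹ • ∑ k ∈ Finset.range N, E (Γ ∩ {a | (k + 1 : ℝ) / N ≤ f a})‖ ≤ (N : ℝ)⁻¹ := by
  have hN' : (0 : ℝ) < N := by exact_mod_cast hN
  have hS := integral_floor (E := E) hΓ hf h0 h1 hN
  have hSsa : IsSelfAdjoint (∑ k ∈ Finset.range N, E (Γ ∩ {a | (k + 1 : ℝ) / N ≤ f a})) :=
    isSelfAdjoint_sum _ fun k _ =>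
      E.isSelfAdjoint_apply (hΓ.inter (measurableSet_le measurable_const hf))
  generalize (∑ k ∈ Finset.range N, E (Γ ∩ {a | (k + 1 : ℝ) / N ≤ f a})) = S at hS hSsa ⊢
  have hfm : Measurable fun a => ((⌊(N : ℝ) * f a⌋₊ : ℕ) : ℝ) :=
    (measurable_from_top (f := fun n : ℕ => (n : ℝ))).comp
      (Nat.measurable_floor.comp (hf.const_mul _))
  have hfl : ∀ a, (0:ℝ) ≤ N * f a - (⌊(N : ℝ) * f a⌋₊ : ℝ) ∧
      N * f a - (⌊(N : ℝ) * f a⌋₊ : ℝ) ≤ 1 := fun a => by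
    have := Nat.floor_le (a := (N : ℝ) * f a) (mul_nonneg hN'.le (h0 a))
    have := Nat.lt_floor_add_one ((N : ℝ) * f a)
    constructor <;> linarith
  have hint : ∀ x, Integrable (fun a => ((⌊(N : ℝ) * f a⌋₊ : ℕ) : ℝ))
      ((E.scalarMeasure x).restrict Γ) := fun x => by
    refine Integrable.of_bound hfm.aestronglyMeasurable (N : ℝ) (ae_of_all _ fun a => ?_)
    rw [Real.norm_of_nonneg (by positivity)]
    have := hfl a
    have := h1 a
    nlinarith
  -- The quadratic form of the error is the integral of the fractional part of `N * f`, divided by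
  -- `N`; the fractional part lies in `[0, 1]`.
  have key : ∀ x, RCLike.re (inner ℂ ((B - (N : ℝ)⁻¹ • S) x) x) =
      (N : ℝ)⁻¹ * ∫ a in Γ, (N * f a - (⌊(N : ℝ) * f a⌋₊ : ℝ)) ∂(E.scalarMeasure x) := by
    intro x
    rw [integral_sub ((hB x).1.const_mul _) (hint x), integral_const_mul, hS,
      sub_apply, inner_sub_left, map_sub, (hB x).2,
      smul_apply, inner_smul_left_eq_smul, RCLike.smul_re, mul_sub, inv_mul_cancel_left₀ hN'.ne']
    rfl
  refine norm_le_of_isPositive (hB.isSelfAdjoint.sub ((IsSelfAdjoint.all ((N : ℝ)⁻¹)).smul hSsa))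
    (by positivity) (fun x => ?_) (fun x => ?_)
  · rw [key]
    exact mul_nonneg (by positivity) (integral_nonneg fun a => (hfl a).1)
  · rw [key, ← hE.scalarMeasure_univ x]
    refine mul_le_mul_of_nonneg_left ?_ (by positivity)
    calc ∫ a in Γ, (N * f a - (⌊(N : ℝ) * f a⌋₊ : ℝ)) ∂(E.scalarMeasure x)
        ≤ ∫ a in Γ, 1 ∂(E.scalarMeasure x) :=
          integral_mono (((hB x).1.const_mul _).sub (hint x)) (integrable_const _)
            fun a => (hfl a).2
      _ = (E.scalarMeasure x).real Γ := by simp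
      _ ≤ (E.scalarMeasure x).real Set.univ := measureReal_mono (Set.subset_univ _)

theorem HasIntegral.tendsto_sum {E : POVM α H} (hE : E.IsNormalized) {Γ : Set α}
    (hΓ : MeasurableSet Γ) {f : α → ℝ} (hf : Measurable f) (h0 : ∀ a, 0 ≤ f a) (h1 : ∀ a, f a ≤ 1)
    {B : H →L[ℂ] H} (hB : E.HasIntegral Γ f B) :
    Tendsto (fun N : ℕ => (N : ℝ)⁻¹ • ∑ k ∈ Finset.range N,
      E (Γ ∩ {a | (k + 1 : ℝ) / N ≤ f a})) atTop (𝓝 B) := by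
  rw [tendsto_iff_norm_sub_tendsto_zero]
  refine squeeze_zero' (.of_forall fun _ => norm_nonneg _) ?_
    (tendsto_inv_atTop_zero.comp (tendsto_natCast_atTop_atTop (R := ℝ)))
  filter_upwards [eventually_gt_atTop 0] with N hN
  rw [norm_sub_rev]
  exact hB.norm_sub_sum_le hE hΓ hf h0 h1 hN

/-- An operator commuting with the values of `E` commutes with all integrals of `[0,1]`-valued
functions. -/
theorem HasIntegral.commute {E : POVM α H} (hE : E.IsNormalized) {Γ : Set α}
    (hΓ : MeasurableSet Γ) {f : α → ℝ} (hf : Measurable f) (h0 : ∀ a, 0 ≤ f a) (h1 : ∀ a, f a ≤ 1)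
    {B : H →L[ℂ] H} (hB : E.HasIntegral Γ f B) {T : H →L[ℂ] H}
    (hT : ∀ S, MeasurableSet S → Commute T (E S)) : Commute T B := by
  have h := hB.tendsto_sum hE hΓ hf h0 h1
  refine tendsto_nhds_unique (h.const_mul T) ((h.mul_const T).congr fun N => ?_)
  have : Commute T ((N : ℝ)⁻¹ • ∑ k ∈ Finset.range N, E (Γ ∩ {a | (k + 1 : ℝ) / N ≤ f a})) :=
    (Commute.sum_right _ _ _ fun k _ =>
      hT _ (hΓ.inter (measurableSet_le measurable_const hf))).smul_right _
  exact this.eq.symm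

end POVM

/-! ### Commutativity of smearings and the Feller property -/

variable {H : Type*} [NormedAddCommGroup H] [InnerProductSpace ℂ H] [CompleteSpace H]

/-- Commutation passes from projections to integrals one factor at a time: `F Δ₁` commutes with
every `E S`, hence with `F Δ₂`. -/
theorem IsSharpRepresentation.isCommutative {F : POVM ℝ H} {A : H →L[ℂ] H}
    {E : POVM (spectrum ℝ A) H} {μ : Set ℝ → spectrum ℝ A → ℝ} {Γ : Set (spectrum ℝ A)}
    (h : IsSharpRepresentation F A E μ Γ) : F.IsCommutative := by
  intro Δ₁ Δ₂ h₁ h₂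
  have hw := h.strong.weak 0
  have hE := h.strong.isPVM
  refine (h.smearing Δ₂ h₂).commute hE.2 h.strong.measurableSet (hw.measurable _ h₂)
    (fun a => (hw.mem_Icc _ h₂ a).1) (fun a => (hw.mem_Icc _ h₂ a).2) fun S hS => ?_
  exact ((h.smearing Δ₁ h₁).commute hE.2 h.strong.measurableSet (hw.measurable _ h₁)
    (fun a => (hw.mem_Icc _ h₁ a).1) (fun a => (hw.mem_Icc _ h₁ a).2) fun T hT =>
      hE.isCommutative S T hS hT).symm

theorem Ioo_mem_rationalRing (a b : ℚ) : Set.Ioo (a : ℝ) (b : ℝ) ∈ rationalRing :=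
  Set.mem_sInter.2 fun _ hC => hC.2 a b

/-- A Markov kernel that is continuous on the open intervals with rational end-points is Feller. -/
theorem isFellerMarkovMap_of_continuous_Ioo {Λ : Type*} [MeasurableSpace Λ] [TopologicalSpace Λ]
    [FirstCountableTopology Λ] {μ : Set ℝ → Λ → ℝ} (hμ : IsMarkovMap μ)
    (hc : ∀ a b : ℚ, Continuous (μ (Set.Ioo (a : ℝ) (b : ℝ)))) : IsFellerMarkovMap μ := by
  obtain ⟨κ, hκ, hμκ⟩ := hμ
  refine ⟨κ, hκ, hμκ, fun f => ⟨?_, ‖f‖, fun l => ?_⟩⟩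
  · rw [continuous_iff_continuousAt]
    intro l
    let S : Set (Set ℝ) := {s | ∃ a b : ℚ, s = Set.Ioo (a : ℝ) (b : ℝ)}
    have hS : IsPiSystem S := by
      rintro _ ⟨a, b, rfl⟩ _ ⟨c, d, rfl⟩ -
      exact ⟨a ⊔ c, b ⊓ d, by rw [Set.Ioo_inter_Ioo]; push_cast; rfl⟩
    let ν : Λ → ProbabilityMeasure ℝ := fun l => ⟨κ l, inferInstance⟩
    -- The rational intervals form a π-system containing arbitrarily small neighbourhoods of every
    -- point, so convergence of their masses already gives weak convergence.
    have ht : Tendsto ν (𝓝 l) (𝓝 (ν l)) := by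
      refine hS.tendsto_probabilityMeasure_of_tendsto_of_mem ?_ ?_ ?_
      · rintro _ ⟨a, b, rfl⟩; exact measurableSet_Ioo
      · intro u hu x hx
        obtain ⟨ε, hε, hεu⟩ := Metric.isOpen_iff.1 hu x hx
        obtain ⟨a, ha1, ha2⟩ := exists_rat_btwn (sub_lt_self x hε)
        obtain ⟨b, hb1, hb2⟩ := exists_rat_btwn (lt_add_of_pos_right x hε)
        refine ⟨_, ⟨a, b, rfl⟩, Ioo_mem_nhds ha2 hb1, fun y hy => hεu ?_⟩
        rw [Metric.mem_ball, Real.dist_eq, abs_lt]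
        constructor <;> linarith [hy.1, hy.2]
      · rintro _ ⟨a, b, rfl⟩
        have h := (hc a b).tendsto l
        rw [show μ (Set.Ioo (a : ℝ) (b : ℝ)) = fun l => (κ l).real (Set.Ioo (a : ℝ) (b : ℝ)) from
          funext (hμκ _ measurableSet_Ioo)] at h
        rw [← NNReal.tendsto_coe]
        exact h
    exact (ProbabilityMeasure.tendsto_iff_forall_integral_tendsto.1 ht) f
  · rw [← Real.norm_eq_abs]
    exact f.norm_integral_le_norm (κ l)

theorem IsSharpRepresentation.isFellerMarkovMap {F : POVM ℝ H} {A : H →L[ℂ] H}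
    {E : POVM (spectrum ℝ A) H} {μ : Set ℝ → spectrum ℝ A → ℝ} {Γ : Set (spectrum ℝ A)}
    (h : IsSharpRepresentation F A E μ Γ) : IsFellerMarkovMap (fun Δ (l : Γ) => μ Δ l) :=
  isFellerMarkovMap_of_continuous_Ioo h.strong.markov fun a b =>
    (h.continuous _ (Ioo_mem_rationalRing a b)).comp continuous_subtype_val

/-! ### Limits in the weak operator topology -/

namespace ContinuousLinearMap

theorem tendsto_inner_of_tendsto_inner_self {H : Type*} [NormedAddCommGroup H]
    [InnerProductSpace ℂ H] {T : ℕ → H →L[ℂ] H} {q : H → ℂ}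
    (hq : ∀ x, Tendsto (fun n => inner ℂ (T n x) x) atTop (𝓝 (q x))) (x y : H) :
    Tendsto (fun n => inner ℂ (T n x) y) atTop (𝓝 ((q (x + y) - q (x - y) -
      Complex.I * q (x + Complex.I • y) + Complex.I * q (x - Complex.I • y)) / 4)) := by
  have h : ∀ n, inner ℂ (T n x) y = _ := fun n => inner_map_polarization' (T n : H →ₗ[ℂ] H) x y
  simp_rw [h]
  exact ((((hq _).sub (hq _)).sub ((hq _).const_mul _)).add ((hq _).const_mul _)).div_const _

/-- A bounded sequence of operators whose quadratic forms converge pointwise converges in the weak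
operator topology. -/
theorem exists_tendsto_inner_of_tendsto_inner_self {T : ℕ → H →L[ℂ] H} {C : ℝ}
    (hC : ∀ n, ‖T n‖ ≤ C) {q : H → ℂ}
    (hq : ∀ x, Tendsto (fun n => inner ℂ (T n x) x) atTop (𝓝 (q x))) :
    ∃ S : H →L[ℂ] H, ∀ x y, Tendsto (fun n => inner ℂ (T n x) y) atTop (𝓝 (inner ℂ (S x) y)) := by
  have h : ∀ x y, ∃ l, Tendsto (fun n => inner ℂ (T n x) y) atTop (𝓝 l) := fun x y =>
    ⟨_, tendsto_inner_of_tendsto_inner_self hq x y⟩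
  choose b hb using h
  -- By polarization the limits exist off the diagonal too. They form a bounded sesquilinear form,
  -- which the Riesz representation theorem turns into an operator.
  let B : H →ₗ⋆[ℂ] H →ₗ[ℂ] ℂ := LinearMap.mk₂'ₛₗ (starRingEnd ℂ) (RingHom.id ℂ) b
    (fun x x' y => tendsto_nhds_unique (hb (x + x') y)
      (((hb x y).add (hb x' y)).congr fun n => by simp))
    (fun c x y => tendsto_nhds_unique (hb (c • x) y)
      (((hb x y).const_mul (starRingEnd ℂ c)).congr fun n => by simp [mul_comm]))
    (fun x y y' => tendsto_nhds_unique (hb x (y + y'))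
      (((hb x y).add (hb x y')).congr fun n => by simp))
    (fun c x y => tendsto_nhds_unique (hb x (c • y))
      (((hb x y).const_mul c).congr fun n => by simp))
  have hB : ∀ x y, ‖B x y‖ ≤ C * ‖x‖ * ‖y‖ := fun x y => by
    refine le_of_tendsto (hb x y).norm (.of_forall fun n => (norm_inner_le_norm _ _).trans ?_)
    gcongr
    exact (T n).le_of_opNorm_le (hC n) x
  refine ⟨InnerProductSpace.continuousLinearMapOfBilin (B.mkContinuous₂ C hB), fun x y => ?_⟩
  rw [InnerProductSpace.continuousLinearMapOfBilin_apply]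
  exact hb x y

theorem commute_of_tendsto_inner {T : ℕ → H →L[ℂ] H} {S R : H →L[ℂ] H}
    (h : ∀ x y, Tendsto (fun n => inner ℂ (T n x) y) atTop (𝓝 (inner ℂ (S x) y)))
    (hR : ∀ n, Commute R (T n)) : Commute R S := by
  ext x
  refine ext_inner_right ℂ fun y => ?_
  rw [mul_apply_eq_comp, mul_apply_eq_comp, ← ContinuousLinearMap.adjoint_inner_right]
  refine tendsto_nhds_unique (h x _) ((h (R x) y).congr fun n => ?_)
  rw [ContinuousLinearMap.adjoint_inner_right, ← mul_apply_eq_comp, ← mul_apply_eq_comp, (hR n).eq]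

theorem isSelfAdjoint_of_inner_self_real {T : H →L[ℂ] H} {m : H → ℝ}
    (h : ∀ x, inner ℂ (T x) x = (m x : ℂ)) : IsSelfAdjoint T := by
  rw [ContinuousLinearMap.isSelfAdjoint_iff_isSymmetric,
    LinearMap.isSymmetric_iff_inner_map_self_real]
  intro x
  erw [h x]
  exact Complex.conj_ofReal _

end ContinuousLinearMap

theorem MeasureTheory.hasSum_measureReal_iUnion {α : Type*} [MeasurableSpace α] (μ : Measure α)
    [IsFiniteMeasure μ] {Δ : ℕ → Set α} (hΔ : ∀ n, MeasurableSet (Δ n))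
    (hd : Pairwise (Function.onFun Disjoint Δ)) :
    HasSum (fun n => μ.real (Δ n)) (μ.real (⋃ n, Δ n)) := by
  simp only [measureReal_def]
  rw [measure_iUnion hd hΔ, ENNReal.tsum_toReal_eq fun n => measure_ne_top _ _]
  exact ENNReal.hasSum_toReal (by rw [← measure_iUnion hd hΔ]; exact measure_ne_top _ _)

/-! ### The spectral resolution of a bounded self-adjoint operator -/

namespace IsSelfAdjoint

variable {A : H →L[ℂ] H} (hA : IsSelfAdjoint A)

theorem inner_cfcHom_self (f : C(spectrum ℝ A, ℝ)) (x : H) :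
    inner ℂ (cfcHom hA f x) x = ((RCLike.re (inner ℂ (cfcHom hA f x) x) : ℝ) : ℂ) :=
  ((ContinuousLinearMap.isSelfAdjoint_iff_isSymmetric.1
    ((IsSelfAdjoint.all f).map (cfcHom hA))).coe_re_inner_apply_self x).symm

/-- The positive functional `f ↦ ⟨f(A) x, x⟩`. -/
def spectralFunctional (x : H) : CompactlySupportedContinuousMap (spectrum ℝ A) ℝ →ₚ[ℝ] ℝ where
  toFun f := RCLike.re (inner ℂ (cfcHom hA f.toContinuousMap x) x)
  map_add' f g := by
    have : (f + g).toContinuousMap = f.toContinuousMap + g.toContinuousMap := rfl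
    simp [this]
  map_smul' c f := by
    have : (c • f).toContinuousMap = c • f.toContinuousMap := rfl
    rw [this, map_smul, smul_apply, inner_smul_left_eq_smul, RCLike.smul_re]
    rfl
  monotone' f g hfg := by
    have h : cfcHom hA f.toContinuousMap ≤ cfcHom hA g.toContinuousMap := cfcHom_mono hA hfg
    rw [ContinuousLinearMap.le_def] at h
    have := h.re_inner_nonneg_left x
    rw [sub_apply, inner_sub_left, map_sub] at this
    exact sub_nonneg.1 this

/-- The spectral measure of `A` at the vector `x`. -/
def spectralMeasure (x : H) : Measure (spectrum ℝ A) :=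
  RealRMK.rieszMeasure (hA.spectralFunctional x)

instance (x : H) : IsFiniteMeasure (hA.spectralMeasure x) := by
  unfold spectralMeasure; infer_instance

theorem integral_spectralMeasure (x : H) (f : C(spectrum ℝ A, ℝ)) :
    ∫ l, f l ∂(hA.spectralMeasure x) = RCLike.re (inner ℂ (cfcHom hA f x) x) :=
  RealRMK.integral_rieszMeasure (hA.spectralFunctional x)
    ⟨f, HasCompactSupport.of_compactSpace _⟩

theorem spectralMeasure_univ (x : H) : (hA.spectralMeasure x).real Set.univ = ‖x‖ ^ 2 := by
  have := hA.integral_spectralMeasure x 1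
  rw [map_one, one_apply_eq_self, inner_self_eq_norm_sq] at this
  simpa using this

theorem eq_spectralMeasure {x : H} {ν : Measure (spectrum ℝ A)} [IsFiniteMeasure ν]
    (h : ∀ f : C(spectrum ℝ A, ℝ), ∫ l, f l ∂ν = RCLike.re (inner ℂ (cfcHom hA f x) x)) :
    ν = hA.spectralMeasure x :=
  ext_of_forall_integral_eq_of_IsFiniteMeasure fun f =>
    (h f.toContinuousMap).trans (hA.integral_spectralMeasure x f.toContinuousMap).symm

theorem norm_le_one_of_inner_self {T : H →L[ℂ] H} {m : H → ℝ}
    (h : ∀ x, inner ℂ (T x) x = (m x : ℂ)) (h0 : ∀ x, 0 ≤ m x) (h1 : ∀ x, m x ≤ ‖x‖ ^ 2) :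
    ‖T‖ ≤ 1 := by
  have e : ∀ x, RCLike.re (inner ℂ (T x) x) = m x := fun x => by rw [h x]; rfl
  refine POVM.norm_le_of_isPositive (ContinuousLinearMap.isSelfAdjoint_of_inner_self_real h)
    zero_le_one (fun x => ?_) (fun x => ?_)
  · rw [e]; exact h0 x
  · rw [e, one_mul]; exact h1 x

/-- The indicator of a closed set is a pointwise limit of continuous functions with values in `[0,
1]`, and the corresponding operators converge weakly. The commutation clause is carried along
because orthogonality of the resolution depends on it. -/
theorem exists_spectralOperator_of_isClosed {F : Set (spectrum ℝ A)} (hF : IsClosed F) :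
    ∃ T : H →L[ℂ] H, (∀ x, inner ℂ (T x) x = (((hA.spectralMeasure x).real F : ℝ) : ℂ)) ∧
      ∀ S, Commute S A → Commute S T := by
  let f : ℕ → C(spectrum ℝ A, ℝ) := fun n => ⟨fun l => (hF.apprSeq n l : ℝ), by fun_prop⟩
  have hf : ∀ n x, inner ℂ (cfcHom hA (f n) x) x =
      ((∫ l, f n l ∂(hA.spectralMeasure x) : ℝ) : ℂ) := fun n x => by
    rw [hA.inner_cfcHom_self, hA.integral_spectralMeasure]
  have hq : ∀ x, Tendsto (fun n => inner ℂ (cfcHom hA (f n) x) x) atTop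
      (𝓝 (((hA.spectralMeasure x).real F : ℝ) : ℂ)) := fun x => by
    simp_rw [hf]
    refine (Complex.continuous_ofReal.tendsto _).comp ?_
    have := HasOuterApproxClosed.tendsto_lintegral_apprSeq hF (hA.spectralMeasure x)
    have := (ENNReal.tendsto_toReal (measure_ne_top _ _)).comp this
    refine this.congr fun n => ?_
    exact BoundedContinuousFunction.toReal_lintegral_coe_eq_integral _ _
  have h01 : ∀ n l, 0 ≤ f n l ∧ f n l ≤ 1 := fun n l =>
    ⟨NNReal.coe_nonneg _, by exact_mod_cast HasOuterApproxClosed.apprSeq_apply_le_one hF n l⟩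
  have hC : ∀ n, ‖cfcHom hA (f n)‖ ≤ 1 := fun n =>
    norm_le_one_of_inner_self (hf n) (fun x => integral_nonneg fun l => (h01 n l).1) fun x => by
      rw [← hA.spectralMeasure_univ x]
      calc ∫ l, f n l ∂(hA.spectralMeasure x) ≤ ∫ l, 1 ∂(hA.spectralMeasure x) :=
            integral_mono ((f n).continuous.integrable_of_hasCompactSupport
              (HasCompactSupport.of_compactSpace _)) (integrable_const _) fun l => (h01 n l).2
        _ = _ := by simp
  obtain ⟨T, hT⟩ := ContinuousLinearMap.exists_tendsto_inner_of_tendsto_inner_self hC hq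
  refine ⟨T, fun x => tendsto_nhds_unique (hT x x) (hq x), fun S hS =>
    ContinuousLinearMap.commute_of_tendsto_inner hT fun n => ?_⟩
  exact (Commute.cfcHom hA hS.symm (by rw [hA.star_eq]; exact hS.symm) (f n)).symm

/-- The sets admitting such an operator contain the closed sets and are stable under complements and
countable disjoint unions; Dynkin's π-λ argument then gives all Borel sets. -/
theorem exists_spectralOperator {Δ : Set (spectrum ℝ A)} (hΔ : MeasurableSet Δ) :
    ∃ T : H →L[ℂ] H, (∀ x, inner ℂ (T x) x = (((hA.spectralMeasure x).real Δ : ℝ) : ℂ)) ∧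
      ∀ S, Commute S A → Commute S T := by
  have hgen : (inferInstance : MeasurableSpace (spectrum ℝ A)) =
      MeasurableSpace.generateFrom {s | IsClosed s} := by
    rw [← borel_eq_generateFrom_isClosed]; exact BorelSpace.measurable_eq
  induction Δ, hΔ using MeasurableSpace.induction_on_inter hgen isPiSystem_isClosed with
  | empty => exact ⟨0, by simp, fun S _ => Commute.zero_right S⟩
  | basic F hF => exact hA.exists_spectralOperator_of_isClosed hF
  | compl Δ hΔ ih =>
    obtain ⟨T, hT, hc⟩ := ih
    refine ⟨1 - T, fun x => ?_, fun S hS => (Commute.one_right S).sub_right (hc S hS)⟩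
    rw [sub_apply, inner_sub_left, hT, one_apply_eq_self, inner_self_eq_norm_sq_to_K,
      measureReal_compl hΔ, spectralMeasure_univ]
    simp
  | iUnion Δ hd hΔ ih =>
    choose T hT hc using ih
    have hs : ∀ n x, inner ℂ ((∑ k ∈ Finset.range n, T k) x) x =
        ((∑ k ∈ Finset.range n, (hA.spectralMeasure x).real (Δ k) : ℝ) : ℂ) := fun n x => by
      rw [sum_apply, sum_inner]
      push_cast
      exact Finset.sum_congr rfl fun k _ => hT k x
    have hsum := fun x => hasSum_measureReal_iUnion (hA.spectralMeasure x) hΔ hd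
    have hC : ∀ n, ‖∑ k ∈ Finset.range n, T k‖ ≤ 1 := fun n =>
      norm_le_one_of_inner_self (hs n)
        (fun x => Finset.sum_nonneg fun k _ => measureReal_nonneg) fun x => by
        rw [← hA.spectralMeasure_univ x]
        exact (sum_le_hasSum _ (fun k _ => measureReal_nonneg) (hsum x)).trans
          (measureReal_mono (Set.subset_univ _))
    have hq : ∀ x, Tendsto (fun n => inner ℂ ((∑ k ∈ Finset.range n, T k) x) x) atTop
        (𝓝 (((hA.spectralMeasure x).real (⋃ k, Δ k) : ℝ) : ℂ)) := fun x => by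
      simp_rw [hs]
      exact (Complex.continuous_ofReal.tendsto _).comp (hsum x).tendsto_sum_nat
    obtain ⟨S, hS⟩ := ContinuousLinearMap.exists_tendsto_inner_of_tendsto_inner_self hC hq
    exact ⟨S, fun x => tendsto_nhds_unique (hS x x) (hq x), fun R hR =>
      ContinuousLinearMap.commute_of_tendsto_inner hS fun n =>
        Commute.sum_right _ _ _ fun k _ => hc k R hR⟩

open Classical in
/-- The value of the spectral resolution of `A` on a set. -/
def spectralOperator (Δ : Set (spectrum ℝ A)) : H →L[ℂ] H :=
  if h : MeasurableSet Δ then (hA.exists_spectralOperator h).choose else 0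

theorem inner_spectralOperator {Δ : Set (spectrum ℝ A)} (hΔ : MeasurableSet Δ) (x : H) :
    inner ℂ (hA.spectralOperator Δ x) x = (((hA.spectralMeasure x).real Δ : ℝ) : ℂ) := by
  rw [spectralOperator, dif_pos hΔ]
  exact (hA.exists_spectralOperator hΔ).choose_spec.1 x

theorem commute_spectralOperator {S : H →L[ℂ] H} (hS : Commute S A) (Δ : Set (spectrum ℝ A)) :
    Commute S (hA.spectralOperator Δ) := by
  rw [spectralOperator]
  split_ifs with hΔ
  · exact (hA.exists_spectralOperator hΔ).choose_spec.2 S hS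
  · exact Commute.zero_right S

/-- The spectral resolution of a bounded self-adjoint operator. -/
def spectralPOVM : POVM (spectrum ℝ A) H where
  toFun := hA.spectralOperator
  isPositive Δ hΔ := by
    refine ⟨ContinuousLinearMap.isSelfAdjoint_iff_isSymmetric.1
      (ContinuousLinearMap.isSelfAdjoint_of_inner_self_real (hA.inner_spectralOperator hΔ)),
      fun x => ?_⟩
    rw [ContinuousLinearMap.reApplyInnerSelf, hA.inner_spectralOperator hΔ]
    exact measureReal_nonneg
  hasSum_iUnion Δ hΔ hd x y := by
    have hq : ∀ x, HasSum (fun n => inner ℂ (hA.spectralOperator (Δ n) x) x)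
        (inner ℂ (hA.spectralOperator (⋃ n, Δ n) x) x) := fun x => by
      simp_rw [hA.inner_spectralOperator (hΔ _), hA.inner_spectralOperator (.iUnion hΔ)]
      exact Complex.ofRealCLM.hasSum (hasSum_measureReal_iUnion (hA.spectralMeasure x) hΔ hd)
    have h : ∀ T : H →L[ℂ] H, inner ℂ (T x) y = _ := fun T =>
      inner_map_polarization' (T : H →ₗ[ℂ] H) x y
    simp_rw [h]
    exact ((((hq _).sub (hq _)).sub ((hq _).mul_left _)).add ((hq _).mul_left _)).div_const _

theorem spectralPOVM_scalarMeasure (x : H) :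
    hA.spectralPOVM.scalarMeasure x = hA.spectralMeasure x := by
  ext Δ hΔ
  have h : inner ℂ (hA.spectralPOVM Δ x) x = _ := hA.inner_spectralOperator hΔ x
  rw [POVM.scalarMeasure_apply _ _ hΔ, h]
  exact ENNReal.ofReal_toReal (measure_ne_top _ _)

theorem spectralPOVM_hasIntegral (f : C(spectrum ℝ A, ℝ)) :
    hA.spectralPOVM.HasIntegral Set.univ f (cfcHom hA f) := fun x => by
  refine ⟨(f.continuous.integrable_of_hasCompactSupport
    (HasCompactSupport.of_compactSpace _)).integrableOn, ?_⟩
  rw [Measure.restrict_univ, spectralPOVM_scalarMeasure, integral_spectralMeasure]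
  exact hA.inner_cfcHom_self f x

theorem spectralPOVM_hasIntegral_id :
    hA.spectralPOVM.HasIntegral Set.univ (fun l => (l : ℝ)) A := by
  have := hA.spectralPOVM_hasIntegral ((ContinuousMap.id ℝ).restrict (spectrum ℝ A))
  rwa [cfcHom_id] at this

/-- For continuous `f` one has `⟨f(A) g(A) x, g(A) x⟩ = ⟨(f g²)(A) x, x⟩`, and a finite measure is
determined by its integrals of continuous functions. -/
theorem spectralMeasure_cfcHom (g : C(spectrum ℝ A, ℝ)) (x : H) :
    hA.spectralMeasure (cfcHom hA g x) =
      (hA.spectralMeasure x).withDensity fun l => ENNReal.ofReal ((g * g) l) := by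
  have hm : Measurable fun l => ENNReal.ofReal ((g * g) l) :=
    ENNReal.measurable_ofReal.comp (g * g).continuous.measurable
  have hi : Integrable (g * g) (hA.spectralMeasure x) :=
    (g * g).continuous.integrable_of_hasCompactSupport (HasCompactSupport.of_compactSpace _)
  have := isFiniteMeasure_withDensity_ofReal hi.2
  symm
  refine hA.eq_spectralMeasure fun f => ?_
  rw [integral_withDensity_eq_integral_toReal_smul hm (ae_of_all _ fun _ => ENNReal.ofReal_lt_top)]
  have hsa : IsSelfAdjoint (cfcHom hA g) := (IsSelfAdjoint.all g).map (cfcHom hA)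
  rw [← ContinuousLinearMap.adjoint_inner_left, hsa.adjoint_eq, ← mul_apply_eq_comp,
    ← mul_apply_eq_comp, ← map_mul, ← map_mul, ← hA.integral_spectralMeasure]
  refine integral_congr_ae (ae_of_all _ fun l => ?_)
  simp only [ContinuousMap.mul_apply, smul_eq_mul]
  rw [ENNReal.toReal_ofReal (mul_self_nonneg _)]
  ring

/-- Both sides compute `⟨E(Δ) g(A) x, g(A) x⟩`: once through the density `g²`, once by commuting
`g(A)` past `E(Δ)`. -/
theorem setIntegral_spectralMeasure_mul_self {Δ : Set (spectrum ℝ A)} (hΔ : MeasurableSet Δ)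
    (x : H) (g : C(spectrum ℝ A, ℝ)) :
    ∫ l in Δ, (g * g) l ∂(hA.spectralMeasure x) =
      RCLike.re (inner ℂ ((cfcHom hA (g * g) * hA.spectralPOVM Δ) x) x) := by
  have hm : Measurable fun l => ENNReal.ofReal ((g * g) l) :=
    ENNReal.measurable_ofReal.comp (g * g).continuous.measurable
  have hsa : IsSelfAdjoint (cfcHom hA g) := (IsSelfAdjoint.all g).map (cfcHom hA)
  have hc : Commute (cfcHom hA g) (hA.spectralPOVM Δ) :=
    hA.commute_spectralOperator (Commute.cfcHom hA (Commute.refl A)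
      (by rw [hA.star_eq]; exact Commute.refl A) g) Δ
  have h : inner ℂ (hA.spectralPOVM Δ (cfcHom hA g x)) (cfcHom hA g x) = _ :=
    hA.inner_spectralOperator hΔ (cfcHom hA g x)
  rw [← ContinuousLinearMap.adjoint_inner_left, hsa.adjoint_eq, ← mul_apply_eq_comp,
    ← mul_apply_eq_comp, mul_assoc, ← hc.eq, ← mul_assoc, ← map_mul,
    hA.spectralMeasure_cfcHom] at h
  rw [h]
  have := setIntegral_withDensity_eq_setIntegral_toReal_smul (μ := hA.spectralMeasure x) hm
    (ae_of_all _ fun _ => ENNReal.ofReal_lt_top) (fun _ => (1 : ℝ)) hΔ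
  simp only [integral_const, smul_eq_mul, mul_one, measureReal_restrict_apply_univ] at this
  rw [this]
  refine integral_congr_ae (ae_of_all _ fun l => ?_)
  exact (ENNReal.toReal_ofReal (mul_self_nonneg _)).symm

theorem setIntegral_spectralMeasure {Δ : Set (spectrum ℝ A)} (hΔ : MeasurableSet Δ)
    (x : H) (f : C(spectrum ℝ A, ℝ)) :
    ∫ l in Δ, f l ∂(hA.spectralMeasure x) =
      RCLike.re (inner ℂ ((cfcHom hA f * hA.spectralPOVM Δ) x) x) := by
  -- Writing `f = ((f + 1)/2)² - ((f - 1)/2)²` reduces the claim to squares.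
  let g : C(spectrum ℝ A, ℝ) := (1 / 2 : ℝ) • (f + 1)
  let k : C(spectrum ℝ A, ℝ) := (1 / 2 : ℝ) • (f - 1)
  have hf : f = g * g - k * k := by
    ext l
    simp only [g, k, ContinuousMap.sub_apply, ContinuousMap.mul_apply, ContinuousMap.smul_apply,
      ContinuousMap.add_apply, ContinuousMap.one_apply, smul_eq_mul]
    ring
  have hi : ∀ h : C(spectrum ℝ A, ℝ), Integrable h ((hA.spectralMeasure x).restrict Δ) := fun h =>
    h.continuous.integrable_of_hasCompactSupport (HasCompactSupport.of_compactSpace _)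
  rw [hf, map_sub, sub_mul, sub_apply, inner_sub_left, map_sub,
    ← hA.setIntegral_spectralMeasure_mul_self hΔ, ← hA.setIntegral_spectralMeasure_mul_self hΔ,
    ← integral_sub (hi _) (hi _)]
  rfl

theorem spectralPOVM_isPVM : hA.spectralPOVM.IsPVM := by
  constructor
  · intro Δ₁ Δ₂ h₁ h₂ hd
    refine ContinuousLinearMap.ext_inner_self fun x => ?_
    have hp : (0 : H →L[ℂ] H) ≤ hA.spectralPOVM Δ₂ :=
      (ContinuousLinearMap.nonneg_iff_isPositive _).2 (hA.spectralPOVM.isPositive Δ₂ h₂)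
    -- With `C² = E(Δ₂)` and `C` commuting with `A`, the spectral measure at `C x` is the one at `x`
    -- restricted to `Δ₂`. Hence `⟨E(Δ₁) E(Δ₂) x, x⟩ = ⟨E(Δ₁) C x, C x⟩` is the mass of `Δ₁ ∩ Δ₂`.
    -- Idempotence of `E(Δ₂)` is not needed.
    set C := CFC.sqrt (hA.spectralPOVM Δ₂)
    have hCC : C * C = hA.spectralPOVM Δ₂ := CFC.sqrt_mul_sqrt_self _ hp
    have hCsa : IsSelfAdjoint C := (CFC.sqrt_nonneg _).isSelfAdjoint
    have hAE : Commute A (hA.spectralPOVM Δ₂) := hA.commute_spectralOperator (Commute.refl A) Δ₂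
    have hCA : Commute C A := hAE.symm.cfcₙ_nnreal _
    have hinner : ∀ T : H →L[ℂ] H, Commute C T →
        inner ℂ (T (C x)) (C x) = inner ℂ ((T * hA.spectralPOVM Δ₂) x) x := fun T hT => by
      rw [← ContinuousLinearMap.adjoint_inner_left, hCsa.adjoint_eq, ← mul_apply_eq_comp,
        ← mul_apply_eq_comp, hT.eq, mul_assoc, hCC]
    have hm : (hA.spectralMeasure x).restrict Δ₂ = hA.spectralMeasure (C x) := by
      refine hA.eq_spectralMeasure fun f => ?_
      rw [hinner _ (Commute.cfcHom hA hCA.symm (by rw [hA.star_eq]; exact hCA.symm) f).symm]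
      exact hA.setIntegral_spectralMeasure h₂ x f
    rw [← hinner (hA.spectralPOVM Δ₁) (hA.commute_spectralOperator hCA Δ₁)]
    have h : inner ℂ (hA.spectralPOVM Δ₁ (C x)) (C x) = _ :=
      hA.inner_spectralOperator h₁ (C x)
    rw [h, ← hm, measureReal_restrict_apply h₁, hd.inter_eq]
    simp
  · refine ContinuousLinearMap.ext_inner_self fun x => ?_
    have h : inner ℂ (hA.spectralPOVM Set.univ x) x = _ :=
      hA.inner_spectralOperator MeasurableSet.univ x
    rw [h, spectralMeasure_univ, one_apply_eq_self, inner_self_eq_norm_sq_to_K]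
    simp

end IsSelfAdjoint

/-! ### Continuous digits on the Cantor set -/

namespace Ternary

/-- The weight of the `k`-th digit of a point of the Cantor set. -/
def weight (k : ℕ) : ℝ := 2 / 3 * (1 / 3) ^ k

/-- A continuous function which is `0` on `[0, 1/3]` and `1` on `[2/3, 1]`. -/
def leadingDigit (t : ℝ) : ℝ := max 0 (min 1 (3 * t - 1))

/-- Removal of the leading digit. -/
def shift (t : ℝ) : ℝ := 3 * t - 2 * leadingDigit t

/-- A continuous function computing the `k`-th digit of a point of the Cantor set. -/
def digit (k : ℕ) (t : ℝ) : ℝ := leadingDigit (shift^[k] t)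

theorem weight_nonneg (k : ℕ) : 0 ≤ weight k := by unfold weight; positivity

theorem hasSum_weight : HasSum weight 1 := by
  have := (hasSum_geometric_of_lt_one (r := (1 / 3 : ℝ)) (by norm_num) (by norm_num)).mul_left
    (2 / 3)
  convert! this using 1
  norm_num

theorem weight_succ (k : ℕ) : weight (k + 1) = weight k / 3 := by unfold weight; ring

theorem continuous_leadingDigit : Continuous leadingDigit := by
  unfold leadingDigit; fun_prop

theorem continuous_digit (k : ℕ) : Continuous (digit k) := by
  have : Continuous shift := by
    unfold shift; exact (continuous_const.mul continuous_id).sub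
      (continuous_const.mul continuous_leadingDigit)
  exact continuous_leadingDigit.comp (this.iterate k)

theorem digit_nonneg (k : ℕ) (t : ℝ) : 0 ≤ digit k t := le_max_left _ _

theorem digit_le_one (k : ℕ) (t : ℝ) : digit k t ≤ 1 := max_le zero_le_one (min_le_left _ _)

theorem hasSum_mem_Icc {d : ℕ → ℝ} (h0 : ∀ k, 0 ≤ d k) (h1 : ∀ k, d k ≤ 1) {t : ℝ}
    (ht : HasSum (fun k => weight k * d k) t) : t ∈ Set.Icc (0 : ℝ) 1 :=
  ⟨ht.nonneg fun k => mul_nonneg (weight_nonneg k) (h0 k),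
    hasSum_le (fun k => mul_le_of_le_one_right (weight_nonneg k) (h1 k)) ht hasSum_weight⟩

theorem hasSum_sub_leading {d : ℕ → ℝ} {t : ℝ} (ht : HasSum (fun k => weight k * d k) t) :
    HasSum (fun k => weight k * d (k + 1)) (3 * t - 2 * d 0) := by
  have := ((hasSum_nat_add_iff' 1).2 ht).mul_left 3
  convert! this using 1
  · ext k; rw [weight_succ]; ring
  · simp [weight]; ring

/-- The shifted sum lies in `[0, 1]`, so `t` is in `[0, 1/3]` or `[2/3, 1]` according to its first
digit. The gap between these intervals is what allows the digit to be continuous. -/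
theorem leadingDigit_of_hasSum {d : ℕ → ℝ} (hd : ∀ k, d k = 0 ∨ d k = 1) {t : ℝ}
    (ht : HasSum (fun k => weight k * d k) t) : leadingDigit t = d 0 := by
  have := hasSum_mem_Icc (fun k => by rcases hd (k + 1) with h | h <;> simp [h])
    (fun k => by rcases hd (k + 1) with h | h <;> simp [h]) (hasSum_sub_leading ht)
  rw [leadingDigit]
  rcases hd 0 with h | h <;> rw [h] at this ⊢
  · rw [max_eq_left]; exact min_le_of_right_le (by linarith [this.2])
  · rw [min_eq_left (by linarith [this.1]), max_eq_right zero_le_one]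

theorem digit_of_hasSum {d : ℕ → ℝ} (hd : ∀ k, d k = 0 ∨ d k = 1) {t : ℝ}
    (ht : HasSum (fun k => weight k * d k) t) (k : ℕ) : digit k t = d k := by
  induction k generalizing d t with
  | zero => exact leadingDigit_of_hasSum hd ht
  | succ k ih =>
    refine ih (d := fun k => d (k + 1)) (fun k => hd _) ?_
    rw [shift, leadingDigit_of_hasSum hd ht]
    exact hasSum_sub_leading ht

end Ternary

/-! ### One generator for commuting projections -/

open Ternary

theorem cfc_digit_of_hasSum {𝒜 : Type*} [CommCStarAlgebra 𝒜] {p : ℕ → 𝒜}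
    (hp : ∀ k, IsStarProjection (p k)) {a : 𝒜} (ha : HasSum (fun k => weight k • p k) a) (k : ℕ) :
    cfc (digit k) a = p k := by
  have hsa : IsSelfAdjoint a := by
    have h := ha.star
    simp only [star_smul, (hp _).isSelfAdjoint.star_eq, star_trivial] at h
    exact h.unique ha
  -- In a commutative C⋆-algebra it suffices to test on characters; there projections become `0` or
  -- `1` and `a` becomes a ternary expansion with digits `0` and `2`.
  refine (gelfandTransform_isometry 𝒜).injective (ContinuousMap.ext fun φ => ?_)
  change φ (cfc (digit k) a) = φ (p k)
  have hd : ∀ j, ∃ r : ℝ, (r = 0 ∨ r = 1) ∧ φ (p j) = (r : ℂ) := fun j => by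
    have h : φ (p j) * φ (p j) = φ (p j) := by rw [← map_mul, (hp j).isIdempotentElem.eq]
    rcases IsIdempotentElem.iff_eq_zero_or_one.1 h with h | h
    · exact ⟨0, .inl rfl, by simp [h]⟩
    · exact ⟨1, .inr rfl, by simp [h]⟩
  choose d hd hφ using hd
  have hφc : Continuous φ := map_continuous φ
  have hs : HasSum (fun j => ((weight j * d j : ℝ) : ℂ)) (φ a) := by
    have := ha.map φ hφc
    convert! this using 1
    ext j
    simp only [Function.comp]
    rw [← Complex.coe_smul, map_smul, hφ]
    simp
  have hsum : Summable fun j => weight j * d j := Complex.summable_ofReal.1 hs.summable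
  have hφa : φ a = algebraMap ℝ ℂ (∑' j, weight j * d j) :=
    hs.unique (Complex.hasSum_ofReal.2 hsum.hasSum)
  rw [StarAlgHomClass.map_cfc (S := ℂ) φ (digit k) a (continuous_digit k).continuousOn hφc hsa
    (hsa.map φ), hφa, cfc_algebraMap, digit_of_hasSum hd hsum.hasSum, hφ]
  rfl

/-- A sequence of commuting projections lies in the C⋆-algebra generated by one self-adjoint
operator with spectrum in `[0,1]`. -/
theorem exists_generator {H : Type*} [NormedAddCommGroup H] [InnerProductSpace ℂ H]
    [CompleteSpace H] {P : ℕ → H →L[ℂ] H} (hP : ∀ k, IsStarProjection (P k))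
    (hc : ∀ j k, Commute (P j) (P k)) :
    ∃ (A : H →L[ℂ] H) (hA : IsSelfAdjoint A) (p : ℕ → C(spectrum ℝ A, ℝ)),
      spectrum ℝ A ⊆ Set.Icc 0 1 ∧ (∀ k, cfcHom hA (p k) = P k) ∧
      ∀ l, HasSum (fun k => weight k * p k l) l := by
  -- The Gelfand argument needs a commutative algebra, so it is run in the closed star subalgebra
  -- generated by the projections.
  let S := (StarAlgebra.adjoin ℂ (Set.range P)).topologicalClosure
  have hcomm : ∀ x y : StarAlgebra.adjoin ℂ (Set.range P), x * y = y * x := by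
    have := StarAlgebra.isMulCommutative_adjoin ℂ (s := Set.range P)
      (by rintro _ ⟨j, rfl⟩ _ ⟨k, rfl⟩; exact hc j k)
      (by rintro _ ⟨j, rfl⟩ _ ⟨k, rfl⟩; rw [(hP k).isSelfAdjoint.star_eq]; exact hc j k)
    exact this.is_comm.comm
  have hclosed : IsClosed (S : Set (H →L[ℂ] H)) := StarSubalgebra.isClosed_topologicalClosure _
  let _ : CommCStarAlgebra S :=
    { StarSubalgebra.cstarAlgebra S (h_closed := hclosed) with
      mul_comm := (StarSubalgebra.commRingTopologicalClosure _ hcomm).mul_comm }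
  have hmem : ∀ k, P k ∈ S := fun k => StarSubalgebra.le_topologicalClosure _
    (StarAlgebra.subset_adjoin ℂ _ ⟨k, rfl⟩)
  let p : ℕ → S := fun k => ⟨P k, hmem k⟩
  have hp : ∀ k, IsStarProjection (p k) := fun k =>
    ⟨Subtype.ext (hP k).isIdempotentElem, Subtype.ext (hP k).isSelfAdjoint⟩
  have hnorm : ∀ k, ‖p k‖ ≤ 1 := fun k => (hP k).norm_le
  have hsum : Summable fun k => weight k • p k := by
    refine Summable.of_norm_bounded hasSum_weight.summable fun k => ?_
    rw [norm_smul, Real.norm_of_nonneg (weight_nonneg k)]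
    exact mul_le_of_le_one_right (weight_nonneg k) (hnorm k)
  obtain ⟨a, ha⟩ := hsum
  have hAsum : HasSum (fun k => weight k • P k) (a : H →L[ℂ] H) :=
    ha.map (S.subtype : S →⋆ₐ[ℂ] H →L[ℂ] H) continuous_subtype_val
  have hsa : IsSelfAdjoint a := by
    have h := ha.star
    simp only [star_smul, (hp _).isSelfAdjoint.star_eq, star_trivial] at h
    exact h.unique ha
  have hA : IsSelfAdjoint (a : H →L[ℂ] H) := hsa.map S.subtype
  have hcfc : ∀ k, cfc (digit k) (a : H →L[ℂ] H) = P k := fun k => by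
    have := StarAlgHom.map_cfc (R := ℝ) S.subtype (digit k) a (continuous_digit k).continuousOn
      continuous_subtype_val hsa hA
    rw [cfc_digit_of_hasSum hp ha] at this
    exact this.symm
  let q : ℕ → C(spectrum ℝ (a : H →L[ℂ] H), ℝ) := fun k =>
    ⟨fun l => digit k l, (continuous_digit k).comp continuous_subtype_val⟩
  have hq : ∀ k, cfcHom hA (q k) = P k := fun k => by
    rw [← hcfc k, cfc_apply (digit k) _ hA (continuous_digit k).continuousOn]
    rfl
  have hqs : Summable fun k => weight k • q k := by
    refine Summable.of_norm_bounded hasSum_weight.summable fun k => ?_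
    rw [norm_smul, Real.norm_of_nonneg (weight_nonneg k)]
    refine mul_le_of_le_one_right (weight_nonneg k)
      ((ContinuousMap.norm_le _ zero_le_one).2 fun l => ?_)
    change ‖digit k l‖ ≤ 1
    rw [Real.norm_of_nonneg (digit_nonneg k _)]
    exact digit_le_one k _
  -- Injectivity of the functional calculus turns `∑ weight k • P k = A` into the expansion of the
  -- identity function, so every spectral point is the sum of its weighted digits.
  have hid : HasSum (fun k => weight k • q k)
      ((ContinuousMap.id ℝ).restrict (spectrum ℝ (a : H →L[ℂ] H))) := by
    obtain ⟨g, hg⟩ := hqs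
    have h := hg.map (cfcHom hA) (cfcHom_continuous hA)
    have hfun : (cfcHom hA ∘ fun k => weight k • q k) = fun k => weight k • P k := by
      ext1 k
      rw [Function.comp, map_smul, hq]
    rw [hfun] at h
    have : g = (ContinuousMap.id ℝ).restrict (spectrum ℝ (a : H →L[ℂ] H)) :=
      cfcHom_injective hA ((h.unique hAsum).trans (cfcHom_id hA).symm)
    rwa [this] at hg
  have hl : ∀ l : spectrum ℝ (a : H →L[ℂ] H), HasSum (fun k => weight k * q k l) l := fun l =>
    hid.map (ContinuousMap.evalCLM ℝ l) (ContinuousMap.evalCLM ℝ l).continuous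
  refine ⟨a, hA, q, fun l hl' => ?_, hq, hl⟩
  exact hasSum_mem_Icc (fun k => digit_nonneg k _) (fun k => digit_le_one k _) (hl ⟨l, hl'⟩)

/-! ### Commuting contractions as functions of one operator -/

/-- Functions with the same integral with respect to a PVM agree almost everywhere. -/
theorem POVM.IsPVM.ae_eq_of_hasIntegral {α : Type*} [MeasurableSpace α] {E : POVM α H}
    (hE : E.IsPVM) {f g : α → ℝ} {B : H →L[ℂ] H} (hf : E.HasIntegral Set.univ f B)
    (hg : E.HasIntegral Set.univ g B) (x : H) : f =ᵐ[E.scalarMeasure x] g := by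
  have hfi := integrableOn_univ.1 (hf x).1
  have hgi := integrableOn_univ.1 (hg x).1
  refine ae_eq_of_forall_setIntegral_eq_of_sigmaFinite (fun s _ _ => hfi.integrableOn)
    (fun s _ _ => hgi.integrableOn) fun s hs _ => ?_
  -- Testing at the vector `E s x` localizes the equality of integrals to `s`.
  have h := (hf (E s x)).2.symm.trans (hg (E s x)).2
  rw [Measure.restrict_univ, hE.scalarMeasure_apply_vector hs] at h
  exact_mod_cast h

theorem POVM.IsNormalized.apply_le_one {α : Type*} [MeasurableSpace α] {F : POVM α H}
    (hF : F.IsNormalized) {Δ : Set α} (hΔ : MeasurableSet Δ) : F Δ ≤ 1 := by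
  rw [ContinuousLinearMap.le_def, ← F.apply_compl hF hΔ]
  exact F.isPositive _ hΔ.compl

theorem POVM.apply_mono {α : Type*} [MeasurableSpace α] (F : POVM α H)
    {S T : Set α} (hS : MeasurableSet S) (hT : MeasurableSet T) (hST : S ⊆ T) : F S ≤ F T := by
  rw [ContinuousLinearMap.le_def]
  have : F T = F S + F (T \ S) := by
    rw [← F.apply_union hS (hT.diff hS) Set.disjoint_sdiff_right, Set.union_sdiff_cancel hST]
  rw [this, add_sub_cancel_left]
  exact F.isPositive _ (hT.diff hS)

theorem IsSelfAdjoint.cfcHom_le_iff {A : H →L[ℂ] H} (hA : IsSelfAdjoint A)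
    {f g : C(spectrum ℝ A, ℝ)} : cfcHom hA f ≤ cfcHom hA g ↔ f ≤ g := by
  rw [← sub_nonneg, ← map_sub, cfcHom_nonneg_iff, sub_nonneg]

/-- The spectral resolution of `f(A)` is the image under `f` of the one of `A`. -/
theorem IsSelfAdjoint.map_spectralMeasure_cfcHom {A B : H →L[ℂ] H} (hA : IsSelfAdjoint A)
    (hB : IsSelfAdjoint B) {f : C(spectrum ℝ A, ℝ)} (hf : cfcHom hA f = B) (x : H) :
    (hB.spectralMeasure x).map (Subtype.val) = (hA.spectralMeasure x).map f := by
  subst hf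
  refine ext_of_forall_integral_eq_of_IsFiniteMeasure fun h => ?_
  rw [integral_map measurable_subtype_coe.aemeasurable h.continuous.aestronglyMeasurable,
    integral_map f.continuous.aemeasurable h.continuous.aestronglyMeasurable]
  have hr : ∀ l, f l ∈ spectrum ℝ (cfcHom hA f) := fun l => by
    rw [cfcHom_map_spectrum]; exact ⟨l, rfl⟩
  let f' : C(spectrum ℝ A, spectrum ℝ (cfcHom hA f)) :=
    ⟨fun l => ⟨f l, hr l⟩, f.continuous.subtype_mk hr⟩
  let g : C(spectrum ℝ (cfcHom hA f), ℝ) := ⟨fun t => h t, h.continuous.comp continuous_subtype_val⟩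
  have h1 := hB.integral_spectralMeasure x g
  rw [← cfcHom_comp hA f f' (fun _ => rfl) g, ← hA.integral_spectralMeasure] at h1
  exact h1

theorem IsSelfAdjoint.spectralPOVM_cfcHom {A B : H →L[ℂ] H} (hA : IsSelfAdjoint A)
    (hB : IsSelfAdjoint B) {f : C(spectrum ℝ A, ℝ)} (hf : cfcHom hA f = B) {S : Set ℝ}
    (hS : MeasurableSet S) :
    hB.spectralPOVM (Subtype.val ⁻¹' S) = hA.spectralPOVM (f ⁻¹' S) := by
  refine ContinuousLinearMap.ext_inner_self fun x => ?_
  rw [POVM.inner_apply_self _ _ (measurable_subtype_coe hS),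
    POVM.inner_apply_self _ _ (f.continuous.measurable hS), spectralPOVM_scalarMeasure,
    spectralPOVM_scalarMeasure, ← map_measureReal_apply measurable_subtype_coe hS,
    ← map_measureReal_apply f.continuous.measurable hS, hA.map_spectralMeasure_cfcHom hB hf]

theorem POVM.hasIntegral_indicator_one {α : Type*} [MeasurableSpace α] (E : POVM α H) {S : Set α}
    (hS : MeasurableSet S) : E.HasIntegral Set.univ (S.indicator 1) (E S) := fun x => by
  refine ⟨(integrable_indicator_iff hS).2 (integrable_const (1 : ℝ)).integrableOn, ?_⟩
  rw [Measure.restrict_univ, integral_indicator_one hS, E.inner_apply_self x hS]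

/-- `B` is a norm limit of averages of its spectral projections at the levels `(k + 1)/N`, and the
range of the functional calculus is closed. Rational levels suffice, which keeps the family of
projections countable. -/
theorem mem_range_cfcHom_of_spectralPOVM_mem {A B : H →L[ℂ] H} (hA : IsSelfAdjoint A)
    (hB0 : 0 ≤ B) (hB1 : B ≤ 1)
    (h : ∀ q : ℚ, ∃ g : C(spectrum ℝ A, ℝ),
      cfcHom hA g = hB0.isSelfAdjoint.spectralPOVM (Subtype.val ⁻¹' Set.Ici (q : ℝ))) :
    ∃ f : C(spectrum ℝ A, ℝ), cfcHom hA f = B := by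
  have hB := hB0.isSelfAdjoint
  have h0 : ∀ t : spectrum ℝ B, (0 : ℝ) ≤ t := fun t => spectrum_nonneg_of_nonneg hB0 t.2
  have h1 : ∀ t : spectrum ℝ B, (t : ℝ) ≤ 1 := fun t =>
    (le_algebraMap_iff_spectrum_le (r := (1 : ℝ)) (a := B)).1 (by simpa using hB1) t t.2
  have ht := hB.spectralPOVM_hasIntegral_id.tendsto_sum hB.spectralPOVM_isPVM.2 .univ
    measurable_subtype_coe h0 h1
  have hcl : IsClosed (Set.range (cfcHom hA : C(spectrum ℝ A, ℝ) → H →L[ℂ] H)) :=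
    (cfcHom_isClosedEmbedding hA).isClosed_range
  refine hcl.mem_of_tendsto ht (.of_forall fun N => ?_)
  choose g hg using h
  refine ⟨(N : ℝ)⁻¹ • ∑ k ∈ Finset.range N, g ((k + 1 : ℚ) / N), ?_⟩
  rw [map_smul, map_sum]
  congr 1
  refine Finset.sum_congr rfl fun k _ => ?_
  rw [hg, Set.univ_inter]
  congr 1
  ext t
  simp

/-- A sequence of commuting positive contractions consists of continuous functions of one
self-adjoint operator `A`, and these functions separate almost all points of the spectrum. -/
theorem exists_separating_generator {B : ℕ → H →L[ℂ] H} (h0 : ∀ n, 0 ≤ B n) (h1 : ∀ n, B n ≤ 1)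
    (hc : ∀ m n, Commute (B m) (B n)) :
    ∃ (A : H →L[ℂ] H) (hA : IsSelfAdjoint A) (f : ℕ → C(spectrum ℝ A, ℝ)) (Γ : Set (spectrum ℝ A)),
      spectrum ℝ A ⊆ Set.Icc 0 1 ∧ (∀ n, cfcHom hA (f n) = B n) ∧ MeasurableSet Γ ∧
      (∀ x, ∀ᵐ l ∂(hA.spectralPOVM.scalarMeasure x), l ∈ Γ) ∧
      ∀ l ∈ Γ, ∀ l' ∈ Γ, (∀ n, f n l = f n l') → l = l' := by
  have hB : ∀ n, IsSelfAdjoint (B n) := fun n => (h0 n).isSelfAdjoint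
  let e : ℕ ≃ ℕ × ℚ := (Denumerable.eqv (ℕ × ℚ)).symm
  let Q : ℕ × ℚ → H →L[ℂ] H := fun i =>
    (hB i.1).spectralPOVM (Subtype.val ⁻¹' Set.Ici (i.2 : ℝ))
  have hmeas : ∀ (n : ℕ) (q : ℚ),
      MeasurableSet ((Subtype.val : spectrum ℝ (B n) → ℝ) ⁻¹' Set.Ici (q : ℝ)) := fun n q =>
    measurable_subtype_coe measurableSet_Ici
  have hQ : ∀ i, IsStarProjection (Q i) := fun i =>
    ⟨(hB i.1).spectralPOVM_isPVM.apply_mul_self (hmeas _ _),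
      (hB i.1).spectralPOVM.isSelfAdjoint_apply (hmeas _ _)⟩
  have hQc : ∀ i j, Commute (Q i) (Q j) := fun i j =>
    (hB j.1).commute_spectralOperator
      ((hB i.1).commute_spectralOperator (hc j.1 i.1) _).symm _
  obtain ⟨A, hA, p, hspec, hp, hsum⟩ := exists_generator (fun k => hQ (e k)) (fun j k => hQc _ _)
  have hpi : ∀ i, cfcHom hA (p (e.symm i)) = Q i := fun i => by rw [hp, e.apply_symm_apply]
  have hf : ∀ n, ∃ f : C(spectrum ℝ A, ℝ), cfcHom hA f = B n := fun n =>
    mem_range_cfcHom_of_spectralPOVM_mem hA (h0 n) (h1 n) fun q => ⟨_, hpi (n, q)⟩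
  choose f hf using hf
  -- On this set each digit of `l` is read off from whether some `f n l` reaches a rational level
  -- `q`. The set has full measure since the digit function and the indicator of `{f n ≥ q}`
  -- integrate to the same projection.
  refine ⟨A, hA, f, {l | ∀ i : ℕ × ℚ,
    p (e.symm i) l = (f i.1 ⁻¹' Set.Ici (i.2 : ℝ)).indicator 1 l}, hspec, hf, ?_, ?_, ?_⟩
  · rw [Set.ofPred_forall]
    exact .iInter fun i => measurableSet_eq_fun (p (e.symm i)).continuous.measurable
      (measurable_one.indicator ((f i.1).continuous.measurable measurableSet_Ici))
  · intro x
    refine ae_all_iff.2 fun i => ?_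
    have hi := hA.spectralPOVM_hasIntegral (p (e.symm i))
    rw [hpi] at hi
    refine hA.spectralPOVM_isPVM.ae_eq_of_hasIntegral hi ?_ x
    change POVM.HasIntegral _ _ _ ((hB i.1).spectralPOVM (Subtype.val ⁻¹' Set.Ici (i.2 : ℝ)))
    rw [hA.spectralPOVM_cfcHom (hB i.1) (hf i.1) measurableSet_Ici]
    exact hA.spectralPOVM.hasIntegral_indicator_one
      ((f i.1).continuous.measurable measurableSet_Ici)
  · intro l hl l' hl' h
    have hpk : ∀ k, p k l = p k l' := fun k => by
      have e1 := hl (e k)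
      have e2 := hl' (e k)
      rw [e.symm_apply_apply] at e1 e2
      rw [e1, e2]
      simp only [Set.indicator, Set.mem_preimage, h]
      rfl
    refine Subtype.ext ((hsum l).unique ?_)
    simp_rw [hpk]
    exact hsum l'

/-! ### The Markov kernel of a continuously represented POVM -/

/-- The algebra of sets generated by the open intervals and the closed left half-lines with rational
end-points. -/
def rationalAlgebra : Set (Set ℝ) :=
  generateSetAlgebra (Set.range (fun i : ℚ × ℚ => Set.Ioo (i.1 : ℝ) (i.2 : ℝ)) ∪
    Set.range (fun q : ℚ => Set.Iic (q : ℝ)))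

theorem isSetAlgebra_rationalAlgebra : IsSetAlgebra rationalAlgebra :=
  isSetAlgebra_generateSetAlgebra

theorem countable_rationalAlgebra : rationalAlgebra.Countable :=
  countable_generateSetAlgebra ((Set.countable_range _).union (Set.countable_range _))

theorem Iic_mem_rationalAlgebra (q : ℚ) : Set.Iic (q : ℝ) ∈ rationalAlgebra :=
  self_subset_generateSetAlgebra (.inr ⟨q, rfl⟩)

theorem rationalRing_subset_rationalAlgebra : rationalRing ⊆ rationalAlgebra :=
  Set.sInter_subset_of_mem ⟨isSetAlgebra_rationalAlgebra.isSetRing,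
    fun a b => self_subset_generateSetAlgebra (.inl ⟨(a, b), rfl⟩)⟩

theorem measurableSet_of_mem_rationalAlgebra {Δ : Set ℝ} (hΔ : Δ ∈ rationalAlgebra) :
    MeasurableSet Δ := by
  induction hΔ with
  | base s hs =>
    rcases hs with ⟨i, rfl⟩ | ⟨q, rfl⟩
    · exact measurableSet_Ioo
    · exact measurableSet_Iic
  | empty => exact .empty
  | compl s _ h => exact h.compl
  | union s t _ _ hs ht => exact hs.union ht

/-- `g` represents the restriction of `F` to the rational algebra by continuous functions
of `A`. -/
structure IsContinuousRepresentation (F : POVM ℝ H) {A : H →L[ℂ] H} (hA : IsSelfAdjoint A)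
    (g : Set ℝ → C(spectrum ℝ A, ℝ)) : Prop where
  isNormalized : F.IsNormalized
  cfcHom_eq : ∀ Δ ∈ rationalAlgebra, cfcHom hA (g Δ) = F Δ

namespace IsContinuousRepresentation

variable {F : POVM ℝ H} {A : H →L[ℂ] H} {hA : IsSelfAdjoint A} {g : Set ℝ → C(spectrum ℝ A, ℝ)}
  (hg : IsContinuousRepresentation F hA g)

include hg

theorem nonneg {Δ : Set ℝ} (hΔ : Δ ∈ rationalAlgebra) (l : spectrum ℝ A) : 0 ≤ g Δ l := by
  have : 0 ≤ g Δ := by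
    rw [← cfcHom_nonneg_iff hA, hg.cfcHom_eq _ hΔ]
    exact (ContinuousLinearMap.nonneg_iff_isPositive _).2
      (F.isPositive _ (measurableSet_of_mem_rationalAlgebra hΔ))
  exact this l

theorem mono {Δ Δ' : Set ℝ} (hΔ : Δ ∈ rationalAlgebra) (hΔ' : Δ' ∈ rationalAlgebra) (h : Δ ⊆ Δ')
    (l : spectrum ℝ A) : g Δ l ≤ g Δ' l := by
  have : g Δ ≤ g Δ' := by
    rw [← hA.cfcHom_le_iff, hg.cfcHom_eq _ hΔ, hg.cfcHom_eq _ hΔ']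
    exact F.apply_mono (measurableSet_of_mem_rationalAlgebra hΔ)
      (measurableSet_of_mem_rationalAlgebra hΔ') h
  exact this l

theorem empty : g ∅ = 0 :=
  cfcHom_injective hA (by
    rw [hg.cfcHom_eq _ isSetAlgebra_rationalAlgebra.empty_mem, F.apply_empty, map_zero])

theorem univ : g Set.univ = 1 :=
  cfcHom_injective hA (by
    rw [hg.cfcHom_eq _ isSetAlgebra_rationalAlgebra.univ_mem, hg.isNormalized, map_one])

theorem le_one {Δ : Set ℝ} (hΔ : Δ ∈ rationalAlgebra) (l : spectrum ℝ A) : g Δ l ≤ 1 := by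
  have := hg.mono hΔ isSetAlgebra_rationalAlgebra.univ_mem (Set.subset_univ _) l
  rwa [hg.univ] at this

theorem hasIntegral {Δ : Set ℝ} (hΔ : Δ ∈ rationalAlgebra) :
    hA.spectralPOVM.HasIntegral Set.univ (g Δ) (F Δ) := by
  rw [← hg.cfcHom_eq _ hΔ]; exact hA.spectralPOVM_hasIntegral _

theorem integrable {Δ : Set ℝ} (hΔ : Δ ∈ rationalAlgebra) (x : H) :
    Integrable (g Δ) (hA.spectralPOVM.scalarMeasure x) :=
  integrableOn_univ.1 (hg.hasIntegral hΔ x).1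

theorem integral_eq {Δ : Set ℝ} (hΔ : Δ ∈ rationalAlgebra) (x : H) :
    ∫ l, g Δ l ∂(hA.spectralPOVM.scalarMeasure x) = (F.scalarMeasure x).real Δ := by
  have h := (hg.hasIntegral hΔ x).2
  rw [F.inner_apply_self x (measurableSet_of_mem_rationalAlgebra hΔ), Measure.restrict_univ] at h
  exact_mod_cast h.symm

/-- The sequence is decreasing and bounded below by its candidate limit everywhere; since the
integrals converge to that of the candidate, by continuity of the scalar measure of `F`, the two
limits agree almost everywhere. -/
theorem ae_tendsto_of_antitone {Δ : ℕ → Set ℝ} (hΔ : ∀ n, Δ n ∈ rationalAlgebra)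
    (hm : Antitone Δ) (hi : ⋂ n, Δ n ∈ rationalAlgebra) (x : H) :
    ∀ᵐ l ∂(hA.spectralPOVM.scalarMeasure x),
      Tendsto (fun n => g (Δ n) l) atTop (𝓝 (g (⋂ n, Δ n) l)) := by
  refine tendsto_of_integral_tendsto_of_antitone (fun n => hg.integrable (hΔ n) x)
    (hg.integrable hi x) ?_ (ae_of_all _ fun l m n hmn => hg.mono (hΔ n) (hΔ m) (hm hmn) l)
    (ae_of_all _ fun l n => hg.mono hi (hΔ n) (Set.iInter_subset _ n) l)
  simp_rw [hg.integral_eq (hΔ _), hg.integral_eq hi]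
  exact (ENNReal.tendsto_toReal (measure_ne_top _ _)).comp (tendsto_measure_iInter_atTop
    (fun n => (measurableSet_of_mem_rationalAlgebra (hΔ n)).nullMeasurableSet) hm
    ⟨0, measure_ne_top _ _⟩)

theorem ae_tendsto_of_monotone {Δ : ℕ → Set ℝ} (hΔ : ∀ n, Δ n ∈ rationalAlgebra)
    (hm : Monotone Δ) (hi : ⋃ n, Δ n ∈ rationalAlgebra) (x : H) :
    ∀ᵐ l ∂(hA.spectralPOVM.scalarMeasure x),
      Tendsto (fun n => g (Δ n) l) atTop (𝓝 (g (⋃ n, Δ n) l)) := by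
  refine tendsto_of_integral_tendsto_of_monotone (fun n => hg.integrable (hΔ n) x)
    (hg.integrable hi x) ?_ (ae_of_all _ fun l m n hmn => hg.mono (hΔ m) (hΔ n) (hm hmn) l)
    (ae_of_all _ fun l n => hg.mono (hΔ n) hi (Set.subset_iUnion _ n) l)
  simp_rw [hg.integral_eq (hΔ _), hg.integral_eq hi]
  exact (ENNReal.tendsto_toReal (measure_ne_top _ _)).comp (tendsto_measure_iUnion_atTop hm)

/-- Monotonicity holds everywhere. Each limit condition is continuity along one monotone sequence of
half-lines, and only countably many sequences occur. -/
theorem ae_isRatStieltjesPoint (x : H) :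
    ∀ᵐ l ∂(hA.spectralPOVM.scalarMeasure x),
      IsRatStieltjesPoint (fun l (q : ℚ) => g (Set.Iic (q : ℝ)) l) l := by
  have htop := hg.ae_tendsto_of_monotone (Δ := fun n : ℕ => Set.Iic (((n : ℚ)) : ℝ))
    (fun n => Iic_mem_rationalAlgebra n)
    (fun m n hmn => Set.Iic_subset_Iic.2 (by exact_mod_cast hmn))
  have hbot := hg.ae_tendsto_of_antitone (Δ := fun n : ℕ => Set.Iic (((-n : ℚ)) : ℝ))
    (fun n => Iic_mem_rationalAlgebra (-n))
    (fun m n hmn => Set.Iic_subset_Iic.2 (by exact_mod_cast neg_le_neg (Nat.cast_le.2 hmn)))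
  have hright := fun q : ℚ => hg.ae_tendsto_of_antitone
    (Δ := fun n : ℕ => Set.Iic (((q + 1 / ((n : ℚ) + 1) : ℚ)) : ℝ))
    (fun n => Iic_mem_rationalAlgebra _)
    (fun m n hmn => Set.Iic_subset_Iic.2 (by
      have : (q + 1 / ((n : ℚ) + 1) : ℚ) ≤ q + 1 / ((m : ℚ) + 1) := by gcongr
      exact_mod_cast this))
  have htop' : ⋃ n : ℕ, Set.Iic (((n : ℚ)) : ℝ) = Set.univ := by
    refine Set.eq_univ_of_forall fun t => Set.mem_iUnion.2 ?_
    obtain ⟨n, hn⟩ := exists_nat_ge t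
    exact ⟨n, by simpa using hn⟩
  have hbot' : ⋂ n : ℕ, Set.Iic (((-n : ℚ)) : ℝ) = ∅ := by
    refine Set.eq_empty_of_forall_notMem fun t ht => ?_
    obtain ⟨n, hn⟩ := exists_nat_gt (-t)
    have := Set.mem_iInter.1 ht n
    simp only [Set.mem_Iic, Rat.cast_neg, Rat.cast_natCast] at this
    linarith
  have hright' : ∀ q : ℚ, ⋂ n : ℕ, Set.Iic (((q + 1 / ((n : ℚ) + 1) : ℚ)) : ℝ)
      = Set.Iic (q : ℝ) := fun q => by
    ext t
    simp only [Set.mem_iInter, Set.mem_Iic]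
    push_cast
    constructor
    · intro h
      have ht : Tendsto (fun n : ℕ => (q : ℝ) + 1 / ((n : ℝ) + 1)) atTop (𝓝 q) := by
        simpa using (tendsto_one_div_add_atTop_nhds_zero_nat (𝕜 := ℝ)).const_add (q : ℝ)
      exact ge_of_tendsto' ht h
    · intro h n
      exact h.trans (le_add_of_nonneg_right (by positivity))
  rw [htop', hg.univ] at htop
  rw [hbot', hg.empty] at hbot
  simp_rw [hright'] at hright
  filter_upwards [htop isSetAlgebra_rationalAlgebra.univ_mem x,
    hbot isSetAlgebra_rationalAlgebra.empty_mem x,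
    ae_all_iff.2 fun q => hright q (Iic_mem_rationalAlgebra q) x] with l h1 h2 h3
  have hmono : Monotone fun q : ℚ => g (Set.Iic (q : ℝ)) l := fun q r hqr =>
    hg.mono (Iic_mem_rationalAlgebra q) (Iic_mem_rationalAlgebra r)
      (Set.Iic_subset_Iic.2 (by exact_mod_cast hqr)) l
  refine ⟨hmono, ?_, ?_, fun q => le_antisymm ?_ ?_⟩
  · rw [tendsto_iff_tendsto_subseq_of_monotone hmono tendsto_natCast_atTop_atTop]
    exact h1
  · have ha : Antitone fun q : ℚ => g (Set.Iic ((-q : ℚ) : ℝ)) l := fun q r hqr =>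
      hmono (neg_le_neg hqr)
    have : Tendsto (fun q : ℚ => g (Set.Iic ((-q : ℚ) : ℝ)) l) atTop (𝓝 0) := by
      rw [tendsto_iff_tendsto_subseq_of_antitone ha tendsto_natCast_atTop_atTop]
      exact h2
    have := this.comp tendsto_neg_atBot_atTop
    refine this.congr fun q => ?_
    simp
  · refine ge_of_tendsto' (h3 q) fun n => ?_
    exact ciInf_le (f := fun r : Set.Ioi q => g (Set.Iic ((r : ℚ) : ℝ)) l)
      ⟨0, by rintro _ ⟨r, rfl⟩; exact hg.nonneg (Iic_mem_rationalAlgebra _) l⟩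
      ⟨q + 1 / ((n : ℚ) + 1), lt_add_of_pos_right q (by positivity)⟩
  · have : Nonempty (Set.Ioi q) := ⟨⟨q + 1, lt_add_one q⟩⟩
    exact le_ciInf fun r => hmono (le_of_lt r.2)

/-- A Markov kernel whose distribution functions are almost everywhere given by `g`. -/
theorem exists_kernel : ∃ κ : Kernel (spectrum ℝ A) ℝ, IsMarkovKernel κ ∧
    ∀ Δ : Set ℝ, MeasurableSet Δ →
      hA.spectralPOVM.HasIntegral Set.univ (fun l => (κ l).real Δ) (F Δ) := by
  have hm : Measurable fun l (q : ℚ) => g (Set.Iic (q : ℝ)) l :=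
    measurable_pi_lambda _ fun q => (g (Set.Iic (q : ℝ))).continuous.measurable
  let κ : Kernel (spectrum ℝ A) ℝ :=
    ⟨fun l => (stieltjesOfMeasurableRat _ hm l).measure,
      measurable_measure_stieltjesOfMeasurableRat hm⟩
  have hκ : IsMarkovKernel κ := ⟨fun l => instIsProbabilityMeasure_stieltjesOfMeasurableRat hm l⟩
  refine ⟨κ, hκ, fun Δ hΔ x => ?_⟩
  have hmeas : Measurable fun l => (κ l).real Δ := (κ.measurable_coe hΔ).ennreal_toReal
  have hint : Integrable (fun l => (κ l).real Δ) (hA.spectralPOVM.scalarMeasure x) :=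
    Integrable.of_bound hmeas.aestronglyMeasurable 1 (ae_of_all _ fun l => by
      rw [Real.norm_of_nonneg measureReal_nonneg]; exact measureReal_le_one)
  refine ⟨hint.integrableOn, ?_⟩
  have hIic : ∀ q : ℚ, ∫⁻ l, κ l (Set.Iic (q : ℝ)) ∂(hA.spectralPOVM.scalarMeasure x) =
      F.scalarMeasure x (Set.Iic (q : ℝ)) := fun q => by
    have : ∀ᵐ l ∂(hA.spectralPOVM.scalarMeasure x), κ l (Set.Iic (q : ℝ)) =
        ENNReal.ofReal (g (Set.Iic (q : ℝ)) l) := by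
      filter_upwards [hg.ae_isRatStieltjesPoint x] with l hl
      change (stieltjesOfMeasurableRat _ hm l).measure (Set.Iic (q : ℝ)) = _
      rw [measure_stieltjesOfMeasurableRat_Iic, stieltjesOfMeasurableRat_eq,
        toRatCDF_of_isRatStieltjesPoint hl]
    rw [lintegral_congr_ae this, ← ofReal_integral_eq_lintegral_ofReal
      (hg.integrable (Iic_mem_rationalAlgebra q) x)
      (ae_of_all _ fun l => hg.nonneg (Iic_mem_rationalAlgebra q) l),
      hg.integral_eq (Iic_mem_rationalAlgebra q), ofReal_measureReal]
  -- The mixture of `κ` and the scalar measure of `F` agree on rational half-lines, a generating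
  -- π-system, and have equal total mass; this reaches all Borel sets at once.
  have hbind : (hA.spectralPOVM.scalarMeasure x).bind κ = F.scalarMeasure x := by
    refine ext_of_generate_finite _ Real.borel_eq_generateFrom_Iic_rat Real.isPiSystem_Iic_rat ?_ ?_
    · intro s hs
      obtain ⟨q, rfl⟩ : ∃ q : ℚ, Set.Iic (q : ℝ) = s := by simpa using hs
      rw [Measure.bind_apply measurableSet_Iic κ.measurable.aemeasurable]
      exact hIic q
    · rw [Measure.bind_apply .univ κ.measurable.aemeasurable]
      simp only [measure_univ, lintegral_const, one_mul]
      rw [POVM.scalarMeasure_apply _ _ .univ, POVM.scalarMeasure_apply _ _ .univ, hg.isNormalized,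
        hA.spectralPOVM_isPVM.2]
  rw [Measure.restrict_univ, F.inner_apply_self x hΔ, ← hbind, measureReal_def,
    Measure.bind_apply hΔ κ.measurable.aemeasurable, ← integral_toReal
      (κ.measurable_coe hΔ).aemeasurable (ae_of_all _ fun l => measure_lt_top _ _)]
  rfl

end IsContinuousRepresentation

/-- Countability of the algebra is used twice: to obtain one generator for all its values, and to
gather the exceptional sets of the kernel into one. -/
theorem exists_isSharpRepresentation {F : POVM ℝ H} (hF : F.IsNormalized)
    (hc : F.IsCommutative) :
    ∃ (A : H →L[ℂ] H) (E : POVM (spectrum ℝ A) H) (μ : Set ℝ → spectrum ℝ A → ℝ)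
      (Γ : Set (spectrum ℝ A)), IsSharpRepresentation F A E μ Γ := by
  classical
  obtain ⟨D, hD⟩ := countable_rationalAlgebra.exists_eq_range
    ⟨_, isSetAlgebra_rationalAlgebra.empty_mem⟩
  have hDmem : ∀ n, D n ∈ rationalAlgebra := fun n => hD ▸ ⟨n, rfl⟩
  have hDmeas : ∀ n, MeasurableSet (D n) := fun n =>
    measurableSet_of_mem_rationalAlgebra (hDmem n)
  obtain ⟨A, hA, f, Γ₀, hspec, hf, hΓ₀, hΓ₀ae, hsep⟩ := exists_separating_generator
    (B := fun n => F (D n))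
    (fun n => (ContinuousLinearMap.nonneg_iff_isPositive _).2 (F.isPositive _ (hDmeas n)))
    (fun n => hF.apply_le_one (hDmeas n)) (fun m n => hc _ _ (hDmeas m) (hDmeas n))
  have hex : ∀ Δ, ∃ g : C(spectrum ℝ A, ℝ), Δ ∈ rationalAlgebra → cfcHom hA g = F Δ := fun Δ => by
    by_cases hΔ : Δ ∈ rationalAlgebra
    · obtain ⟨n, rfl⟩ := hD ▸ hΔ
      exact ⟨f n, fun _ => hf n⟩
    · exact ⟨0, fun h => (hΔ h).elim⟩
  choose g hg' using hex
  have hg : IsContinuousRepresentation F hA g := ⟨hF, hg'⟩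
  have hgf : ∀ n, g (D n) = f n := fun n =>
    cfcHom_injective hA ((hg' _ (hDmem n)).trans (hf n).symm)
  obtain ⟨κ, hκ, hint⟩ := hg.exists_kernel
  let E := hA.spectralPOVM
  have hE : E.IsPVM := hA.spectralPOVM_isPVM
  have hκm : ∀ Δ, MeasurableSet Δ → Measurable fun l => (κ l).real Δ := fun Δ hΔ =>
    (κ.measurable_coe hΔ).ennreal_toReal
  -- Two full-measure conditions: the points of `Γ₀` are separated by the representatives, and `κ`
  -- takes exactly the values of these representatives on the algebra.
  let Γ : Set (spectrum ℝ A) := Γ₀ ∩ {l | ∀ n, (κ l).real (D n) = g (D n) l}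
  have hΓm : MeasurableSet Γ := by
    refine hΓ₀.inter ?_
    rw [Set.ofPred_forall]
    exact .iInter fun n => measurableSet_eq_fun (hκm _ (hDmeas n)) (g (D n)).continuous.measurable
  have hΓae : ∀ x, ∀ᵐ l ∂(E.scalarMeasure x), l ∈ Γ := fun x => by
    filter_upwards [hΓ₀ae x, ae_all_iff.2 fun n => hE.ae_eq_of_hasIntegral (hint _ (hDmeas n))
      (hg.hasIntegral (hDmem n)) x] with l h1 h2
    exact ⟨h1, h2⟩
  -- Using `g` on the algebra gives continuity on the whole spectrum, not merely on `Γ`; on `Γ`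
  -- nothing changes, so `μ` is still a Markov kernel there.
  let μ : Set ℝ → spectrum ℝ A → ℝ := fun Δ l =>
    if Δ ∈ rationalAlgebra then g Δ l else (κ l).real Δ
  have hμΓ : ∀ Δ, ∀ l ∈ Γ, μ Δ l = (κ l).real Δ := fun Δ l hl => by
    by_cases hΔ : Δ ∈ rationalAlgebra
    · obtain ⟨n, rfl⟩ := hD ▸ hΔ
      simp only [μ, if_pos hΔ]
      exact (hl.2 n).symm
    · simp only [μ, if_neg hΔ]
  have hμm : ∀ Δ, MeasurableSet Δ → Measurable (μ Δ) := fun Δ hΔ => by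
    by_cases h : Δ ∈ rationalAlgebra
    · simp only [μ, if_pos h]; exact (g Δ).continuous.measurable
    · simp only [μ, if_neg h]; exact hκm Δ hΔ
  refine ⟨A, E, μ, Γ, ?_⟩
  exact {
    isSelfAdjoint := hA
    spectrum_subset := hspec
    eq_integral := hA.spectralPOVM_hasIntegral_id
    strong := {
      isPVM := hE
      weak := fun x => {
        mem_Icc := fun Δ hΔ l => by
          by_cases h : Δ ∈ rationalAlgebra
          · simp only [μ, if_pos h]; exact ⟨hg.nonneg h l, hg.le_one h l⟩
          · simp only [μ, if_neg h]; exact ⟨measureReal_nonneg, measureReal_le_one⟩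
        measurable := hμm
        univ_ae := by
          filter_upwards [hΓae x] with l hl
          rw [hμΓ _ l hl, probReal_univ]
        empty_ae := by
          filter_upwards [hΓae x] with l hl
          rw [hμΓ _ l hl, measureReal_empty]
        hasSum_ae := fun Δ hΔ hd => by
          filter_upwards [hΓae x] with l hl
          simp_rw [hμΓ _ l hl]
          exact hasSum_measureReal_iUnion (κ l) hΔ hd }
      measurableSet := hΓm
      apply_eq_one := by
        refine ContinuousLinearMap.ext_inner_self fun x => ?_
        rw [E.inner_apply_self x hΓm, ← hE.2, E.inner_apply_self x .univ,
          measureReal_congr (s := Γ) (eventuallyEq_univ.2 (hΓae x))]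
      markov := ⟨κ.comap Subtype.val measurable_subtype_coe, inferInstance,
        fun Δ _ l => hμΓ Δ l l.2⟩ }
    continuous := fun Δ hΔ => by
      simp only [μ, if_pos (rationalRing_subset_rationalAlgebra hΔ)]
      exact (g Δ).continuous
    smearing := fun Δ hΔ x => by
      have hres := Measure.restrict_eq_self_of_ae_mem (hΓae x)
      have hae : μ Δ =ᵐ[E.scalarMeasure x] fun l => (κ l).real Δ := by
        filter_upwards [hΓae x] with l hl using hμΓ Δ l hl
      have h := hint Δ hΔ x
      rw [integrableOn_univ, Measure.restrict_univ] at h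
      rw [IntegrableOn, hres, integral_congr_ae hae]
      exact ⟨h.1.congr hae.symm, h.2⟩
    separates := fun l hl l' hl' hne => by
      by_contra! h
      refine hne (hsep l hl.1 l' hl'.1 fun n => ?_)
      rw [← hgf n, ← hl.2 n, ← hl'.2 n, ← hμΓ _ l hl, ← hμΓ _ l' hl']
      exact h _ (hDmeas n) }

end

theorem theorem4p3 {H : Type*} [NormedAddCommGroup H] [InnerProductSpace ℂ H] [CompleteSpace H]
    (F : POVM ℝ H) (hF : F.IsNormalized) :
    (F.IsCommutative ↔
      ∃ (A : H →L[ℂ] H) (E : POVM (spectrum ℝ A) H) (μ : Set ℝ → spectrum ℝ A → ℝ)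
        (Γ : Set (spectrum ℝ A)), IsSharpRepresentation F A E μ Γ) ∧
    ∀ (A : H →L[ℂ] H) (E : POVM (spectrum ℝ A) H) (μ : Set ℝ → spectrum ℝ A → ℝ)
      (Γ : Set (spectrum ℝ A)), IsSharpRepresentation F A E μ Γ →
        IsFellerMarkovMap (fun Δ (l : Γ) => μ Δ l) :=
  ⟨⟨exists_isSharpRepresentation hF, fun ⟨_, _, _, _, h⟩ => h.isCommutative⟩,
    fun _ _ _ _ h => h.isFellerMarkovMap⟩
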